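/- \textbf{Theorem.} {\sc List $3$-Colouring} is polynomial-time solvable for quasi-claw-free graphs of diameter at most~$2$. That is, there is a deterministic polynomial-time algorithm that, given a finite simple graph $G=(V,E)$ that is quasi-claw-free and has diameter at most~$2$, together with a list $L(v)\subseteq\{1,2,3\}$ for every $v\in V$, decides whether there is a map $c:V\to\{1,2,3\}$ with $c(v)\in L(v)$ for every $v\in V$ and $c(u)\neq c(v)$ for every edge $uv\in E$. Here $G$ is \emph{quasi-claw-free} if every two vertices $u,v$ at distance exactly~$2$ have a common neighbour $w$ such that every neighbour of $w$ not in $\{u,v\}$ is adjacent to at least one of $u,v$. The \emph{diameter} of $G$ is the maximum distance between two vertices of $G$, and it is $\infty$ if $G$ is disconnected. -/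

import Mathlib

open Computability

/-- A graph is quasi-claw-free if any two vertices `u`, `v` at distance `2` have a common
neighbour `w` such that every neighbour of `w` outside `{u, v}` is adjacent to `u` or to `v`. -/
def SimpleGraph.IsQuasiClawFree {V : Type*} (G : SimpleGraph V) : Prop :=
  ∀ u v : V, G.dist u v = 2 →
    ∃ w : V, G.Adj u w ∧ G.Adj v w ∧
      ∀ x : V, G.Adj w x → x ≠ u → x ≠ v → G.Adj x u ∨ G.Adj x v

/-- An instance of List `k`-Colouring: a finite graph `G` (with vertices `0, …, n - 1`) and a list
`k`-assignment `L`. The `k` colours are the elements of `Fin k`. -/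
structure ListColouringInstance (k : ℕ) where
  /-- the number of vertices -/
  n : ℕ
  /-- the input graph -/
  G : SimpleGraph (Fin n)
  /-- the lists of admissible colours -/
  L : Fin n → Finset (Fin k)

namespace ListColouringInstance

variable {k : ℕ}

/-- The instance is a yes-instance: `G` has a proper colouring that respects `L`. -/
def HasColouring (I : ListColouringInstance k) : Prop :=
  ∃ c : I.G.Coloring (Fin k), ∀ v, c v ∈ I.L v

open scoped Classical in
/-- The part of the input word that describes the vertex `v`: a comma, then the `k` bits of the
characteristic vector of the list `L v`, then the `n` bits of the row of `v` in the adjacency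
matrix of `G`. -/
noncomputable def encodeVertex (I : ListColouringInstance k) (v : Fin I.n) : List Γ' :=
  Γ'.comma :: (List.ofFn (fun a : Fin k => Γ'.bit (decide (a ∈ I.L v))) ++
    List.ofFn (fun w : Fin I.n => Γ'.bit (decide (I.G.Adj v w))))

/-- The input word of an instance: the descriptions of its vertices one after another. Its length
is `n * (n + k + 1)`. -/
noncomputable def encode (I : ListColouringInstance k) : List Γ' :=
  (List.ofFn I.encodeVertex).flatten

theorem length_encode (I : ListColouringInstance k) :
    I.encode.length = I.n * (I.n + k + 1) := by
  have h : (List.map List.length (List.ofFn I.encodeVertex)) =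
      List.replicate I.n (I.n + k + 1) := by
    rw [List.map_ofFn, ← List.ofFn_const]
    congr 1
    funext v
    simp [encodeVertex]
    omega
  simp [encode, List.length_flatten, h]

/-- Different instances have different input words. -/
theorem encode_injective : Function.Injective (encode (k := k)) := by
  intro I J h
  have hn : I.n = J.n := by
    have hl := congrArg List.length h
    rw [length_encode, length_encode] at hl
    rcases lt_trichotomy I.n J.n with h1 | h1 | h1
    · nlinarith
    · exact h1
    · nlinarith
  obtain ⟨n, G, L⟩ := I
  obtain ⟨m, G', L'⟩ := J
  obtain rfl : n = m := hn
  have hlen : ∀ (H : SimpleGraph (Fin n)) (M : Fin n → Finset (Fin k)),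
      List.map List.length (List.ofFn (encodeVertex ⟨n, H, M⟩)) =
        List.replicate n (n + k + 1) := by
    intro H M
    rw [List.map_ofFn, ← List.ofFn_const]
    congr 1
    funext v
    simp [encodeVertex]
    omega
  have hrows := List.eq_iff_flatten_eq.2 ⟨h, (hlen G L).trans (hlen G' L').symm⟩
  have hv : ∀ v : Fin n, encodeVertex ⟨n, G, L⟩ v = encodeVertex ⟨n, G', L'⟩ v :=
    fun v => congrFun (List.ofFn_injective hrows) v
  have key : ∀ v : Fin n, (∀ a, a ∈ L v ↔ a ∈ L' v) ∧ (∀ w, G.Adj v w ↔ G'.Adj v w) := by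
    intro v
    have h1 := hv v
    simp only [encodeVertex, List.cons.injEq, true_and] at h1
    obtain ⟨ha, hb⟩ := List.append_inj h1 (by simp)
    refine ⟨fun a => ?_, fun w => ?_⟩
    · simpa using congrFun (List.ofFn_injective ha) a
    · simpa using congrFun (List.ofFn_injective hb) w
  have hG : G = G' := by
    ext v w
    exact (key v).2 w
  have hL : L = L' := by
    funext v
    ext a
    exact (key v).1 a
  subst hG hL
  rfl

end ListColouringInstance

open scoped Classical in
/-- The decision problem `P`, restricted to the inputs in `D`, is solvable in polynomial time:
there are one Turing machine and one polynomial `p` such that on the input word `enc x` of every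
`x` in `D` the machine halts after at most `p (length of enc x)` steps with the answer to the
question whether `P x` holds. -/
def IsPolyTimeSolvable {α Γ : Type} (enc : α → List Γ) (D P : α → Prop) : Prop :=
  Nonempty (Turing.TM2ComputableInPolyTime (fun x : {x : α // D x} => enc x.1) encodeBool
    (fun x => decide (P x.1)))

/-! Propagation deletes the colour of each one-colour list from the lists of the neighbours until
nothing changes. Once all lists have at most two colours, the problem is an instance of 2-SAT, and
propagation solves it without backtracking. Suppose a colour is fixed at one vertex and propagation
creates no empty list. Then every list that is not a singleton is untouched, so an old colouring
there, together with the forced colours elsewhere, is again a colouring (`IsGood.of_subset`). A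
choice that survives propagation therefore never has to be revised, and trying the colours vertex by
vertex ends with singletons everywhere (`IsGood.greedy`).

It remains to find boundedly many vertices whose colours cut all lists down to size two
(`hits_ne_nil_iff`). Let `u`, `v` be at distance two, let `w` be the common neighbour from
quasi-claw-freeness, and fix the colours of all three. Any other neighbour of `w` sees `w` and one
of `u`, `v`, hence two different colours, so its own colour is forced. A vertex at distance two from
`w` has a neighbour among these and loses that colour. If no two vertices are at distance two, the
graph is complete and fixing one vertex is enough. The algorithm does not search for `u`, `v`, `w`:
it runs through all triples of decisions. A positive answer is correct on every graph, because
closed singleton lists are a colouring (`exists_isListColouring_of_hits`).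

For the Turing machine, the algorithm is written in a small structured language over stacks.
`Exec.iterate_step` turns its step-counting semantics into steps of a `FinTM2`, the `Spec` lemmas
track stacks and time, and `mainProg_spec` shows that the program decides whether `hits` is nonempty
within a time that is polynomial in the number of vertices, which is at most the input length. -/

/-! ### A structured programming language for machines with finitely many stacks -/

namespace StackProg

open Turing

/-- Structured programs over stacks `k : K` with alphabets `Γ k` and a register of type `σ`. -/
inductive Prog {K : Type} (Γ : K → Type) (σ : Type) : Type
  /-- push a symbol that depends on the register -/
  | push (k : K) (f : σ → Γ k) : Prog Γ σ
  /-- pop a symbol (if there is one) and update the register -/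
  | pop (k : K) (f : σ → Option (Γ k) → σ) : Prog Γ σ
  /-- update the register -/
  | load (f : σ → σ) : Prog Γ σ
  /-- sequential composition -/
  | seq (p q : Prog Γ σ) : Prog Γ σ
  /-- case distinction -/
  | test (b : σ → Bool) (p q : Prog Γ σ) : Prog Γ σ
  /-- as long as the stack `k` is nonempty: pop a symbol, update the register, run the body -/
  | loop (k : K) (f : σ → Γ k → σ) (p : Prog Γ σ) : Prog Γ σ

/-- Sequential composition of programs. -/
infixr:60 " ;; " => Prog.seq

namespace Prog

variable {K : Type} {Γ : K → Type} {σ : Type}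

/-- The program that does nothing. -/
def skip : Prog Γ σ := load id

/-- The labels of the machine code of a program. -/
def Label : Prog Γ σ → Type
  | push _ _ => Unit
  | pop _ _ => Unit
  | load _ => Unit
  | seq p q => p.Label ⊕ q.Label
  | test _ p q => Option (p.Label ⊕ q.Label)
  | loop _ _ p => Option p.Label

/-- There are finitely many labels. -/
@[reducible]
def labelFintype : (p : Prog Γ σ) → Fintype p.Label
  | push _ _ => inferInstanceAs (Fintype Unit)
  | pop _ _ => inferInstanceAs (Fintype Unit)
  | load _ => inferInstanceAs (Fintype Unit)
  | seq p q =>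
    let _ := p.labelFintype
    let _ := q.labelFintype
    inferInstanceAs (Fintype (p.Label ⊕ q.Label))
  | test _ p q =>
    let _ := p.labelFintype
    let _ := q.labelFintype
    inferInstanceAs (Fintype (Option (p.Label ⊕ q.Label)))
  | loop _ _ p =>
    let _ := p.labelFintype
    inferInstanceAs (Fintype (Option p.Label))

/-- The label at which the code of a program starts. -/
def entry : (p : Prog Γ σ) → p.Label
  | push _ _ => ()
  | pop _ _ => ()
  | load _ => ()
  | seq p _ => Sum.inl p.entry
  | test _ _ _ => none
  | loop _ _ _ => none

/-- The machine code of a program, for an embedding `e` of its labels into the labels of the whole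
machine and a label `x` to which the control goes afterwards. The machine has an additional bit
that records whether the last pop of a loop failed. -/
def code {Λ : Type} : (p : Prog Γ σ) → (p.Label → Λ) → Λ → p.Label → TM2.Stmt Γ Λ (σ × Bool)
  | push k f, _, x, _ => .push k (fun v => f v.1) (.goto fun _ => x)
  | pop k f, _, x, _ => .pop k (fun v o => (f v.1 o, false)) (.goto fun _ => x)
  | load f, _, x, _ => .load (fun v => (f v.1, false)) (.goto fun _ => x)
  | seq p q, e, _, Sum.inl l => p.code (fun l => e (Sum.inl l)) (e (Sum.inr q.entry)) l
  | seq _ q, e, x, Sum.inr l => q.code (fun l => e (Sum.inr l)) x l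
  | test b p q, e, _, none =>
    .goto fun v => bif b v.1 then e (some (Sum.inl p.entry)) else e (some (Sum.inr q.entry))
  | test _ p _, e, x, some (Sum.inl l) => p.code (fun l => e (some (Sum.inl l))) x l
  | test _ _ q, e, x, some (Sum.inr l) => q.code (fun l => e (some (Sum.inr l))) x l
  | loop k f p, e, x, none =>
    .pop k (fun v o => o.elim (v.1, true) fun g => (f v.1 g, false))
      (.branch (fun v => v.2) (.load (fun v => (v.1, false)) (.goto fun _ => x))
        (.goto fun _ => e (some p.entry)))
  | loop _ _ p, e, _, some l => p.code (fun l => e (some l)) (e none) l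

/-! ### Step-counting semantics and compilation to machine code. -/

variable [DecidableEq K]

/-- `Exec p v S v' S' t`: started with register `v` and stacks `S`, the program `p` halts after
`t` steps with register `v'` and stacks `S'`. -/
inductive Exec : Prog Γ σ → σ → (∀ k, List (Γ k)) → σ → (∀ k, List (Γ k)) → ℕ → Prop
  | push {k f v S} : Exec (push k f) v S v (Function.update S k (f v :: S k)) 1
  | pop {k f v S} :
      Exec (pop k f) v S (f v (S k).head?) (Function.update S k (S k).tail) 1
  | load {f v S} : Exec (load f) v S (f v) S 1
  | seq {p q v₁ S₁ v₂ S₂ v₃ S₃ t₁ t₂} (h₁ : Exec p v₁ S₁ v₂ S₂ t₁) (h₂ : Exec q v₂ S₂ v₃ S₃ t₂) :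
      Exec (p ;; q) v₁ S₁ v₃ S₃ (t₁ + t₂)
  | test_true {b p q v S v' S' t} (hb : b v = true) (h : Exec p v S v' S' t) :
      Exec (test b p q) v S v' S' (1 + t)
  | test_false {b p q v S v' S' t} (hb : b v = false) (h : Exec q v S v' S' t) :
      Exec (test b p q) v S v' S' (1 + t)
  | loop_nil {k f p v S} (hS : S k = []) : Exec (loop k f p) v S v S 1
  | loop_cons {k f p v₁ S₁ g xs v₂ S₂ v₃ S₃ t₁ t₂} (hS : S₁ k = g :: xs)
      (h₁ : Exec p (f v₁ g) (Function.update S₁ k xs) v₂ S₂ t₁)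
      (h₂ : Exec (loop k f p) v₂ S₂ v₃ S₃ t₂) :
      Exec (loop k f p) v₁ S₁ v₃ S₃ (1 + (t₁ + t₂))

theorem iterate_bind_add {α : Type} {f : α → Option α} {a b c : Option α} {m n : ℕ}
    (h₁ : (flip bind f)^[m] a = b) (h₂ : (flip bind f)^[n] b = c) :
    (flip bind f)^[m + n] a = c := by
  rw [add_comm, Function.iterate_add_apply, h₁, h₂]

/-- The machine code of a program does what the program does. -/
theorem Exec.iterate_step {p : Prog Γ σ} {v S v' S' t} (h : Exec p v S v' S' t) {Λ : Type}
    (M : Λ → TM2.Stmt Γ Λ (σ × Bool)) (e : p.Label → Λ) (x : Λ)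
    (hM : ∀ l, M (e l) = p.code e x l) :
    (flip bind (TM2.step M))^[t] (some ⟨some (e p.entry), (v, false), S⟩) =
      some ⟨some x, (v', false), S'⟩ := by
  -- Subprograms run inside the same machine, but with other label embeddings and exit labels, so
  -- these must vary in the induction.
  induction h generalizing Λ with
  | push => simp [flip, TM2.step, hM, code]
  | pop => simp [flip, TM2.step, hM, code]
  | load => simp [flip, TM2.step, hM, code]
  | @seq p q _ _ _ _ _ _ _ _ _ _ ih₁ ih₂ =>
    exact iterate_bind_add
      (ih₁ M (fun l => e (Sum.inl l)) (e (Sum.inr q.entry)) fun _ => hM _)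
      (ih₂ M (fun l => e (Sum.inr l)) x fun _ => hM _)
  | @test_true b p q _ _ _ _ _ hb _ ih =>
    refine iterate_bind_add (b := some ⟨some (e (some (Sum.inl p.entry))), _, _⟩) ?_
      (ih M (fun l => e (some (Sum.inl l))) x fun _ => hM _)
    refine (congrArg (fun q => some (TM2.stepAux q _ _)) (hM (test b p q).entry)).trans ?_
    simp [entry, code, hb]
  | @test_false b p q _ _ _ _ _ hb _ ih =>
    refine iterate_bind_add (b := some ⟨some (e (some (Sum.inr q.entry))), _, _⟩) ?_
      (ih M (fun l => e (some (Sum.inr l))) x fun _ => hM _)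
    refine (congrArg (fun q => some (TM2.stepAux q _ _)) (hM (test b p q).entry)).trans ?_
    simp [entry, code, hb]
  | @loop_nil k f p v S hS =>
    -- A failed pop writes back the tail of the empty stack, which changes nothing.
    have hu : Function.update S k [] = S := by rw [← hS, Function.update_eq_self]
    refine (congrArg (fun q => some (TM2.stepAux q _ _)) (hM (loop k f p).entry)).trans ?_
    simp [entry, code, hS, hu]
  | @loop_cons k f p _ _ _ _ _ _ _ _ _ _ hS _ _ ih₁ ih₂ =>
    refine iterate_bind_add (b := some ⟨some (e (some p.entry)), _, _⟩) ?_
      (iterate_bind_add (ih₁ M (fun l => e (some l)) (e none) fun _ => hM _)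
        (ih₂ M e x hM))
    refine (congrArg (fun q => some (TM2.stepAux q _ _)) (hM (loop k f p).entry)).trans ?_
    simp [entry, code, hS]

/-- The machine that runs a program and halts. -/
def machine [Fintype K] [Fintype σ] (p : Prog Γ σ) (k₀ k₁ : K) [Fintype (Γ k₀)] (v₀ : σ) :
    FinTM2 where
  K := K
  k₀ := k₀
  k₁ := k₁
  Γ := Γ
  Λ := Option p.Label
  main := some p.entry
  ΛFin := let _ := p.labelFintype; inferInstance
  σ := σ × Bool
  initialState := (v₀, false)
  m l := l.elim .halt (p.code some none)

/-- The initial and halting configurations of a `FinTM2` are given by a cast along `k = k₀`, whereas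
`Exec` works with `Function.update`. -/
theorem update_nil_eq_dite (k₀ : K) (w : List (Γ k₀)) :
    (fun k => if h : k = k₀ then (by rw [h]; exact w : List (Γ k)) else []) =
      Function.update (fun _ => []) k₀ w := by
  funext k
  by_cases h : k = k₀
  · subst h
    simp
  · simp [h]

/-- A program that restores the register and empties all stacks except that for the output gives
rise to a Turing machine for its input-output relation. -/
noncomputable def outputsInTime [Fintype K] [Fintype σ] {p : Prog Γ σ} {k₀ k₁ : K} [Fintype (Γ k₀)] {v₀ : σ}
    {w : List (Γ k₀)} {w' : List (Γ k₁)} {t : ℕ}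
    (h : ∃ t' ≤ t, Exec p v₀ (Function.update (fun _ => []) k₀ w) v₀
      (Function.update (fun _ => []) k₁ w') t') :
    TM2OutputsInTime (p.machine k₀ k₁ v₀) w (some w') (t + 1) where
  -- The additional step executes `halt` at the exit label `none`.
  steps := h.choose + 1
  evals_in_steps := by
    have h₁ := h.choose_spec.2.iterate_step (p.machine k₀ k₁ v₀).m some none fun _ => rfl
    have h₂ := iterate_bind_add (f := TM2.step (p.machine k₀ k₁ v₀).m) (n := 1) h₁ rfl
    refine Eq.trans ?_ (h₂.trans ?_)
    · exact congrArg _ (congrArg (fun S => some (TM2.Cfg.mk _ _ S)) (update_nil_eq_dite k₀ w))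
    · exact congrArg (fun S => some (TM2.Cfg.mk _ _ S)) (update_nil_eq_dite k₁ w').symm
  steps_le_m := Nat.succ_le_succ h.choose_spec.1

end Prog

end StackProg

/-! ### The algorithm: propagation, greedy choices and guesses -/

namespace ListThreeColouring

/-- Remove the colours in `l` from `m` if `b` holds and `l` has exactly one element. -/
def restrict (b : Bool) (l m : Finset (Fin 3)) : Finset (Fin 3) :=
  if b = true ∧ l.card = 1 then m \ l else m

variable {n : ℕ} (A : Fin n → Fin n → Bool)

/-- One round of propagation: the colours of vertices with only one admissible colour are removed
from the lists of their neighbours. -/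
def propStep (L : Fin n → Finset (Fin 3)) : Fin n → Finset (Fin 3) :=
  (List.finRange n).foldl (fun M x y => restrict (A x y) (L x) (M y)) L

/-- Propagation until nothing changes any more. -/
def propagate (L : Fin n → Finset (Fin 3)) : Fin n → Finset (Fin 3) :=
  (propStep A)^[3 * n] L

/-- The vertex at position `j` (if there is one) may only receive the colour `a`. -/
def assign (j : ℕ) (a : Fin 3) (L : Fin n → Finset (Fin 3)) : Fin n → Finset (Fin 3) :=
  fun y => if (y : ℕ) = j then L y ∩ {a} else L y

/-- Assign the colour `a` to the vertex at position `j` and propagate. -/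
def decideAt (j : ℕ) (a : Fin 3) (L : Fin n → Finset (Fin 3)) : Fin n → Finset (Fin 3) :=
  propagate A (assign j a L)

/-- Assign the colour `a` to the vertex at position `j` unless propagation leads to an empty
list. -/
def tryAt (j : ℕ) (a : Fin 3) (L : Fin n → Finset (Fin 3)) : Fin n → Finset (Fin 3) :=
  if ∀ y, decideAt A j a L y ≠ ∅ then decideAt A j a L else L

/-- Try all three colours at position `j`. -/
def tryAll (j : ℕ) (L : Fin n → Finset (Fin 3)) : Fin n → Finset (Fin 3) :=
  tryAt A j 2 (tryAt A j 1 (tryAt A j 0 L))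

/-- Try all colours at the positions `m - 1, …, 0`. -/
def greedy : ℕ → (Fin n → Finset (Fin 3)) → Fin n → Finset (Fin 3)
  | 0, L => L
  | m + 1, L => greedy m (tryAll A m L)

/-- A list of units that is nonempty if the greedy procedure finds a colouring. -/
def greedyHits (L : Fin n → Finset (Fin 3)) : List Unit :=
  if ∀ y, (greedy A (n + 1) L y).card = 1 then [()] else []

/-- Collect the units that `f` produces after all decisions at the positions `m - 1, …, 0`. -/
def guessBelow (f : (Fin n → Finset (Fin 3)) → List Unit) (L : Fin n → Finset (Fin 3)) :
    ℕ → List Unit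
  | 0 => []
  | m + 1 => guessBelow f L m ++
      (f (decideAt A m 2 L) ++ (f (decideAt A m 1 L) ++ f (decideAt A m 0 L)))

/-- Collect the units that `f` produces after all possible decisions. -/
def guess (f : (Fin n → Finset (Fin 3)) → List Unit) (L : Fin n → Finset (Fin 3)) : List Unit :=
  guessBelow A f L (n + 1)

/-- A proper colouring that respects the lists. -/
def IsListColouring (L : Fin n → Finset (Fin 3)) (c : Fin n → Fin 3) : Prop :=
  (∀ x y, A x y = true → c x ≠ c y) ∧ ∀ x, c x ∈ L x

/-- Propagation does not change anything. -/
def IsClosed (L : Fin n → Finset (Fin 3)) : Prop :=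
  ∀ x y, A x y = true → (L x).card = 1 → Disjoint (L x) (L y)

/-! ### Propagation: termination, and invariance of the set of colourings. -/

variable {A}

/-- The singletons are always read off the fixed `L` while only `M` changes, so a round acts
simultaneously and the order of the vertices is irrelevant. -/
theorem mem_foldl_restrict (L : Fin n → Finset (Fin 3)) (xs : List (Fin n))
    (M : Fin n → Finset (Fin 3)) (y : Fin n) (a : Fin 3) :
    a ∈ xs.foldl (fun M x y => restrict (A x y) (L x) (M y)) M y ↔
      a ∈ M y ∧ ∀ x ∈ xs, A x y = true → (L x).card = 1 → a ∉ L x := by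
  induction xs generalizing M with
  | nil => simp
  | cons x xs ih =>
    rw [List.foldl_cons, ih]
    by_cases h : A x y = true ∧ (L x).card = 1
    · simp [restrict, h, and_assoc]
    · simp only [restrict, h, if_false, List.forall_mem_cons]
      tauto

theorem mem_propStep {L : Fin n → Finset (Fin 3)} {y : Fin n} {a : Fin 3} :
    a ∈ propStep A L y ↔ a ∈ L y ∧ ∀ x, A x y = true → (L x).card = 1 → a ∉ L x := by
  simp [propStep, mem_foldl_restrict]

theorem propStep_subset (L : Fin n → Finset (Fin 3)) (y : Fin n) : propStep A L y ⊆ L y :=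
  fun _ h => (mem_propStep.1 h).1

theorem propagate_subset (L : Fin n → Finset (Fin 3)) (y : Fin n) : propagate A L y ⊆ L y := by
  suffices ∀ m, (propStep A)^[m] L y ⊆ L y from this _
  intro m
  induction m with
  | zero => exact subset_rfl
  | succ m ih =>
    rw [Function.iterate_succ_apply']
    exact (propStep_subset _ y).trans ih

theorem propStep_eq_or_sum_card_lt (L : Fin n → Finset (Fin 3)) :
    propStep A L = L ∨ ∑ y, (propStep A L y).card < ∑ y, (L y).card := by
  by_cases h : propStep A L = L
  · exact Or.inl h
  · obtain ⟨y, hy⟩ := Function.ne_iff.1 h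
    exact Or.inr (Finset.sum_lt_sum (fun y _ => Finset.card_le_card (propStep_subset L y))
      ⟨y, Finset.mem_univ y, Finset.card_lt_card ((propStep_subset L y).ssubset_of_ne hy)⟩)

/-- Every round that changes something lowers the total size of the lists, which is at most `3 * n`
at the start. -/
theorem propStep_propagate (L : Fin n → Finset (Fin 3)) :
    propStep A (propagate A L) = propagate A L := by
  have key : ∀ m, propStep A ((propStep A)^[m] L) = (propStep A)^[m] L ∨
      ∑ y, ((propStep A)^[m] L y).card + m ≤ 3 * n := by
    intro m
    induction m with
    | zero =>
      right
      rw [add_zero]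
      calc ∑ y, (L y).card ≤ ∑ _y : Fin n, 3 :=
            Finset.sum_le_sum fun y _ => (Finset.card_le_univ (L y)).trans_eq (Fintype.card_fin 3)
        _ = 3 * n := by simp [mul_comm]
    | succ m ih =>
      rw [Function.iterate_succ_apply']
      rcases propStep_eq_or_sum_card_lt (A := A) ((propStep A)^[m] L) with h | h
      · left
        rw [h, h]
      · rcases ih with ih | ih
        · left
          rw [ih, ih]
        · right
          omega
  rcases key (3 * n) with h | h
  · exact h
  -- After `3 * n` strict decreases the total size is zero, and empty lists are stable.
  · have h0 : ∀ y, propagate A L y = ∅ := by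
      have : ∑ y, (propagate A L y).card = 0 := by
        unfold propagate
        omega
      simpa using this
    funext y
    exact Finset.Subset.antisymm (propStep_subset _ y) (by simp [h0 y])

theorem isClosed_propagate (L : Fin n → Finset (Fin 3)) : IsClosed A (propagate A L) := by
  intro x y hxy hx
  rw [Finset.disjoint_right]
  intro a ha
  rw [← propStep_propagate] at ha
  exact (mem_propStep.1 ha).2 x hxy hx

theorem IsListColouring.propStep {L : Fin n → Finset (Fin 3)} {c : Fin n → Fin 3}
    (h : IsListColouring A L c) : IsListColouring A (propStep A L) c := by
  refine ⟨h.1, fun y => mem_propStep.2 ⟨h.2 y, fun x hxy hx hc => h.1 x y hxy ?_⟩⟩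
  exact Finset.card_le_one.1 hx.le _ (h.2 x) _ hc

theorem IsListColouring.propagate {L : Fin n → Finset (Fin 3)} {c : Fin n → Fin 3}
    (h : IsListColouring A L c) : IsListColouring A (propagate A L) c := by
  suffices ∀ m, IsListColouring A ((ListThreeColouring.propStep A)^[m] L) c from this _
  intro m
  induction m with
  | zero => exact h
  | succ m ih =>
    rw [Function.iterate_succ_apply']
    exact ih.propStep

theorem IsListColouring.mono {L M : Fin n → Finset (Fin 3)} {c : Fin n → Fin 3}
    (h : IsListColouring A L c) (hLM : ∀ y, L y ⊆ M y) : IsListColouring A M c :=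
  ⟨h.1, fun y => hLM y (h.2 y)⟩

theorem assign_subset (j : ℕ) (a : Fin 3) (L : Fin n → Finset (Fin 3)) (y : Fin n) :
    assign j a L y ⊆ L y := by
  unfold assign
  split_ifs
  · exact Finset.inter_subset_left
  · exact subset_rfl

theorem decideAt_subset (j : ℕ) (a : Fin 3) (L : Fin n → Finset (Fin 3)) (y : Fin n) :
    decideAt A j a L y ⊆ L y :=
  (propagate_subset _ y).trans (assign_subset j a L y)

theorem isClosed_decideAt (j : ℕ) (a : Fin 3) (L : Fin n → Finset (Fin 3)) :
    IsClosed A (decideAt A j a L) :=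
  isClosed_propagate _

theorem decideAt_self_subset (x : Fin n) (a : Fin 3) (L : Fin n → Finset (Fin 3)) :
    decideAt A x a L x ⊆ {a} :=
  (propagate_subset _ x).trans (by rw [assign, if_pos rfl]; exact Finset.inter_subset_right)

theorem IsListColouring.decideAt {L : Fin n → Finset (Fin 3)} {c : Fin n → Fin 3}
    (h : IsListColouring A L c) (x : Fin n) :
    IsListColouring A (decideAt A x (c x) L) c := by
  refine IsListColouring.propagate ⟨h.1, fun y => ?_⟩
  unfold assign
  split_ifs with hy
  · rw [Fin.val_injective hy]
    simpa using h.2 x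
  · exact h.2 y

/-! ### Lists of size at most two: greedy choices succeed. -/

/-- A closed satisfiable instance in which all lists have at most two elements. -/
structure IsGood (A : Fin n → Fin n → Bool) (L : Fin n → Finset (Fin 3)) : Prop where
  closed : IsClosed A L
  card_le : ∀ y, (L y).card ≤ 2
  sat : ∃ c, IsListColouring A L c

/-- A list of `M` that is not a singleton has two elements, hence equals the list of `L`, and the
old colour can be kept there. Edges with a singleton end are handled by closedness of `M`, all
others by the old colouring. -/
theorem IsGood.of_subset (hA : ∀ x y, A x y = A y x) {L M : Fin n → Finset (Fin 3)}
    (hL : IsGood A L) (hM : IsClosed A M) (hML : ∀ y, M y ⊆ L y) (hne : ∀ y, M y ≠ ∅) :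
    IsGood A M := by
  classical
  refine ⟨hM, fun y => (Finset.card_le_card (hML y)).trans (hL.card_le y), ?_⟩
  obtain ⟨c, hc⟩ := hL.sat
  have hex : ∀ y, ∃ a ∈ M y, (M y).card ≠ 1 → a = c y := by
    intro y
    by_cases h1 : (M y).card = 1
    · obtain ⟨a, ha⟩ := Finset.nonempty_iff_ne_empty.2 (hne y)
      exact ⟨a, ha, fun h => absurd h1 h⟩
    · refine ⟨c y, ?_, fun _ => rfl⟩
      have h2 : 0 < (M y).card := Finset.card_pos.2 (Finset.nonempty_iff_ne_empty.2 (hne y))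
      have h3 := hL.card_le y
      rw [Finset.eq_of_subset_of_card_le (hML y) (by omega)]
      exact hc.2 y
  choose d hd hdc using hex
  have aux : ∀ x y, A x y = true → (M x).card = 1 → d x ≠ d y := fun x y hxy h he =>
    Finset.disjoint_left.1 (hM x y hxy h) (hd x) (he ▸ hd y)
  refine ⟨d, fun x y hxy => ?_, hd⟩
  by_cases hx : (M x).card = 1
  · exact aux x y hxy hx
  · by_cases hy : (M y).card = 1
    · exact (aux y x (hA x y ▸ hxy) hy).symm
    · rw [hdc x hx, hdc y hy]
      exact hc.1 x y hxy

theorem tryAt_subset (j : ℕ) (a : Fin 3) (L : Fin n → Finset (Fin 3)) (y : Fin n) :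
    tryAt A j a L y ⊆ L y := by
  unfold tryAt
  split_ifs
  · exact decideAt_subset j a L y
  · exact subset_rfl

theorem isClosed_tryAt {L : Fin n → Finset (Fin 3)} (hL : IsClosed A L) (j : ℕ) (a : Fin 3) :
    IsClosed A (tryAt A j a L) := by
  unfold tryAt
  split_ifs
  · exact isClosed_decideAt j a L
  · exact hL

theorem IsGood.tryAt (hA : ∀ x y, A x y = A y x) {L : Fin n → Finset (Fin 3)} (hL : IsGood A L)
    (j : ℕ) (a : Fin 3) : IsGood A (tryAt A j a L) := by
  unfold ListThreeColouring.tryAt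
  split_ifs with h
  · exact hL.of_subset hA (isClosed_decideAt j a L) (decideAt_subset j a L) h
  · exact hL

theorem IsGood.card_eq_one_of_subset {L M : Fin n → Finset (Fin 3)} (hM : IsGood A M)
    (hML : ∀ y, M y ⊆ L y) {y : Fin n} (h : (L y).card ≤ 1) : (M y).card = 1 := by
  obtain ⟨c, hc⟩ := hM.sat
  exact le_antisymm ((Finset.card_le_card (hML y)).trans h) (Finset.card_pos.2 ⟨c y, hc.2 y⟩)

/-- Propagation preserves colourings, so a colour whose propagation empties a list occurs at `x` in
no colouring. -/
theorem tryAt_eq_self_or (x : Fin n) (a : Fin 3) (L : Fin n → Finset (Fin 3)) :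
    (tryAt A x a L x).card ≤ 1 ∨
      tryAt A x a L = L ∧ ∀ c, IsListColouring A L c → c x ≠ a := by
  unfold tryAt
  split_ifs with h
  · exact Or.inl ((Finset.card_le_card (decideAt_self_subset x a L)).trans (by simp))
  · refine Or.inr ⟨rfl, fun c hc hca => h fun y hy => ?_⟩
    have := (hc.decideAt x).2 y
    rw [hca, hy] at this
    simp at this

theorem tryAll_subset (j : ℕ) (L : Fin n → Finset (Fin 3)) (y : Fin n) :
    tryAll A j L y ⊆ L y :=
  (tryAt_subset j 2 _ y).trans ((tryAt_subset j 1 _ y).trans (tryAt_subset j 0 L y))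

theorem isClosed_tryAll {L : Fin n → Finset (Fin 3)} (hL : IsClosed A L) (j : ℕ) :
    IsClosed A (tryAll A j L) :=
  isClosed_tryAt (isClosed_tryAt (isClosed_tryAt hL j 0) j 1) j 2

theorem IsGood.tryAll (hA : ∀ x y, A x y = A y x) {L : Fin n → Finset (Fin 3)} (hL : IsGood A L)
    (j : ℕ) : IsGood A (tryAll A j L) :=
  ((hL.tryAt hA j 0).tryAt hA j 1).tryAt hA j 2

/-- If all three attempts were rejected, the lists would still be `L`, and its colouring would have
no colour left for `x`. -/
theorem card_tryAll_le {L : Fin n → Finset (Fin 3)} (hL : IsGood A L) (x : Fin n) :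
    (tryAll A x L x).card ≤ 1 := by
  unfold tryAll
  have hle : ∀ a M, (tryAt A x a M x).card ≤ (M x).card := fun a M =>
    Finset.card_le_card (tryAt_subset x a M x)
  rcases tryAt_eq_self_or (A := A) x 0 L with h0 | ⟨h0, h0'⟩
  · exact (hle _ _).trans ((hle _ _).trans h0)
  rw [h0]
  rcases tryAt_eq_self_or (A := A) x 1 L with h1 | ⟨h1, h1'⟩
  · exact (hle _ _).trans h1
  rw [h1]
  rcases tryAt_eq_self_or (A := A) x 2 L with h2 | ⟨h2, h2'⟩
  · exact h2
  obtain ⟨c, hc⟩ := hL.sat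
  have e0 := h0' c hc
  have e1 := h1' c hc
  have e2 := h2' c hc
  generalize c x = a at *
  fin_cases a <;> simp at *

theorem greedy_subset (m : ℕ) (L : Fin n → Finset (Fin 3)) (y : Fin n) :
    greedy A m L y ⊆ L y := by
  induction m generalizing L with
  | zero => exact subset_rfl
  | succ m ih => exact (ih _).trans (tryAll_subset m L y)

theorem isClosed_greedy {L : Fin n → Finset (Fin 3)} (hL : IsClosed A L) (m : ℕ) :
    IsClosed A (greedy A m L) := by
  induction m generalizing L with
  | zero => exact hL
  | succ m ih => exact ih (isClosed_tryAll hL m)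

theorem IsGood.greedy (hA : ∀ x y, A x y = A y x) {L : Fin n → Finset (Fin 3)} (hL : IsGood A L)
    (m : ℕ) : IsGood A (greedy A m L) ∧ ∀ x : Fin n, (x : ℕ) < m → (greedy A m L x).card = 1 := by
  induction m generalizing L with
  | zero => exact ⟨hL, fun x hx => absurd hx (Nat.not_lt_zero _)⟩
  | succ m ih =>
    obtain ⟨h1, h2⟩ := ih (hL.tryAll hA m)
    refine ⟨h1, fun x hx => ?_⟩
    rcases Nat.lt_succ_iff_lt_or_eq.1 hx with h | h
    · exact h2 x h
    · subst h
      exact h1.card_eq_one_of_subset (greedy_subset _ _) (card_tryAll_le hL x)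

theorem greedyHits_ne_nil_of_isGood (hA : ∀ x y, A x y = A y x) {L : Fin n → Finset (Fin 3)}
    (hL : IsGood A L) : greedyHits A L ≠ [] := by
  have h := (hL.greedy hA (n + 1)).2
  simp [greedyHits, fun y : Fin n => h y (by omega)]

/-- Closed singleton lists are disjoint along edges. No bound on the sizes of the original lists is
needed. -/
theorem exists_isListColouring_of_greedyHits {L : Fin n → Finset (Fin 3)} (hL : IsClosed A L)
    (h : greedyHits A L ≠ []) : ∃ c, IsListColouring A L c := by
  have h1 : ∀ y, (greedy A (n + 1) L y).card = 1 := by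
    by_contra h1
    exact h (if_neg h1)
  choose c hc using fun y => Finset.card_pos.1 ((h1 y).symm ▸ Nat.one_pos)
  refine ⟨c, fun x y hxy he => ?_, fun y => greedy_subset _ L y (hc y)⟩
  exact Finset.disjoint_left.1 (isClosed_greedy hL (n + 1) x y hxy (h1 x)) (hc x) (he ▸ hc y)

/-! ### Guessed decisions, and correctness on quasi-claw-free graphs of diameter at most two. -/

theorem guessBelow_ne_nil {f : (Fin n → Finset (Fin 3)) → List Unit}
    {L : Fin n → Finset (Fin 3)} {m : ℕ} :
    guessBelow A f L m ≠ [] ↔ ∃ j < m, ∃ a, f (decideAt A j a L) ≠ [] := by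
  induction m with
  | zero => simp [guessBelow]
  | succ m ih =>
    simp only [guessBelow, ne_eq, List.append_eq_nil_iff, Nat.lt_succ_iff_lt_or_eq, or_and_right,
      exists_or, exists_eq_left, Fin.exists_fin_succ] at ih ⊢
    rw [← ih]
    simp
    tauto

theorem exists_isListColouring_of_guess {f : (Fin n → Finset (Fin 3)) → List Unit}
    (hf : ∀ L, IsClosed A L → f L ≠ [] → ∃ c, IsListColouring A L c)
    {L : Fin n → Finset (Fin 3)} (h : guess A f L ≠ []) : ∃ c, IsListColouring A L c := by
  obtain ⟨j, -, a, ha⟩ := guessBelow_ne_nil.1 h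
  obtain ⟨c, hc⟩ := hf _ (isClosed_decideAt j a L) ha
  exact ⟨c, hc.mono (decideAt_subset j a L)⟩

theorem guess_ne_nil {f : (Fin n → Finset (Fin 3)) → List Unit} {L : Fin n → Finset (Fin 3)}
    {j : ℕ} (hj : j ≤ n) (a : Fin 3) (h : f (decideAt A j a L) ≠ []) : guess A f L ≠ [] :=
  guessBelow_ne_nil.2 ⟨j, Nat.lt_succ_of_le hj, a, h⟩

variable (A) in
/-- A list of units that is nonempty if and only if the algorithm answers yes. -/
def hits (L : Fin n → Finset (Fin 3)) : List Unit :=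
  guess A (guess A (guess A (greedyHits A))) L

theorem exists_isListColouring_of_hits {L : Fin n → Finset (Fin 3)} (h : hits A L ≠ []) :
    ∃ c, IsListColouring A L c :=
  exists_isListColouring_of_guess (fun _ _ h => exists_isListColouring_of_guess
    (fun _ _ h => exists_isListColouring_of_guess
      (fun _ hL h => exists_isListColouring_of_greedyHits hL h) h) h) h

/-- The position `n` is allowed as well: it names no vertex, so deciding there is plain propagation.
This provides a branch even for the empty graph. -/
theorem hits_ne_nil_of_isGood (hA : ∀ x y, A x y = A y x) {L : Fin n → Finset (Fin 3)}
    {i j k : ℕ} {a b d : Fin 3} (hi : i ≤ n) (hj : j ≤ n) (hk : k ≤ n)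
    (h : IsGood A (decideAt A k d (decideAt A j b (decideAt A i a L)))) : hits A L ≠ [] :=
  guess_ne_nil hi a (guess_ne_nil hj b (guess_ne_nil hk d (greedyHits_ne_nil_of_isGood hA h)))

/-- It suffices to guess the colours of three vertices such that propagation then leaves at most
two colours for each vertex. -/
theorem hits_ne_nil_of_card_le (hA : ∀ x y, A x y = A y x) {L : Fin n → Finset (Fin 3)}
    {c : Fin n → Fin 3} (hc : IsListColouring A L c) (w u v : Fin n)
    (h : ∀ M, IsClosed A M → IsListColouring A M c → M w = {c w} → M u = {c u} → M v = {c v} →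
      ∀ y, (M y).card ≤ 2) : hits A L ≠ [] := by
  have h1 := hc.decideAt w
  have h2 := h1.decideAt u
  have h3 := h2.decideAt v
  refine hits_ne_nil_of_isGood hA w.2.le u.2.le v.2.le
    ⟨isClosed_decideAt _ _ _, h _ (isClosed_decideAt _ _ _) h3 ?_ ?_ ?_, c, h3⟩
  all_goals refine Finset.Subset.antisymm ?_ (Finset.singleton_subset_iff.2 (h3.2 _))
  · exact (decideAt_subset _ _ _ _).trans
      ((decideAt_subset _ _ _ _).trans (decideAt_self_subset _ _ _))
  · exact (decideAt_subset _ _ _ _).trans (decideAt_self_subset _ _ _)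
  · exact decideAt_self_subset _ _ _

theorem IsClosed.notMem {M : Fin n → Finset (Fin 3)} (hM : IsClosed A M) {x y : Fin n}
    {a : Fin 3} (hxy : A x y = true) (hx : M x = {a}) : a ∉ M y := by
  have h := hM x y hxy (by simp [hx])
  rw [hx] at h
  simpa using h

theorem card_le_two_of_notMem {a : Fin 3} {s : Finset (Fin 3)} (h : a ∉ s) : s.card ≤ 2 :=
  Nat.lt_succ_iff.1 ((Finset.card_lt_univ_of_notMem h).trans_eq (by simp))

theorem eq_singleton_of_notMem {a b d : Fin 3} {s : Finset (Fin 3)} (hd : d ∈ s) (hab : a ≠ b)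
    (ha : a ∉ s) (hb : b ∉ s) : s = {d} := by
  refine Finset.eq_singleton_iff_unique_mem.2 ⟨hd, fun x hx => ?_⟩
  have h1 : a ≠ d := fun h => ha (h ▸ hd)
  have h2 : b ≠ d := fun h => hb (h ▸ hd)
  have h3 : x ≠ a := fun h => ha (h ▸ hx)
  have h4 : x ≠ b := fun h => hb (h ▸ hx)
  omega

/-- The algorithm is correct for quasi-claw-free graphs of diameter at most two. -/
theorem hits_ne_nil_iff {G : SimpleGraph (Fin n)} (hA : ∀ x y, A x y = true ↔ G.Adj x y)
    (hG : G.IsQuasiClawFree) (hd : G.ediam ≤ 2) (L : Fin n → Finset (Fin 3)) :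
    hits A L ≠ [] ↔ ∃ c, IsListColouring A L c := by
  have hs : ∀ x y, A x y = A y x := fun x y => by
    rw [Bool.eq_iff_iff, hA, hA, G.adj_comm]
  refine ⟨exists_isListColouring_of_hits, ?_⟩
  rintro ⟨c, hc⟩
  have hdist : ∀ x y, x = y ∨ G.Adj x y ∨ G.dist x y = 2 := by
    intro x y
    have h1 : G.edist x y ≤ 2 := SimpleGraph.edist_le_ediam.trans hd
    have h2 : G.Reachable x y := SimpleGraph.reachable_of_edist_ne_top
      (ne_top_of_le_ne_top (by simp) h1)
    have h3 : G.dist x y ≤ 2 := by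
      rw [← h2.coe_dist_eq_edist] at h1
      exact_mod_cast h1
    interval_cases h : G.dist x y
    · exact Or.inl (h2.dist_eq_zero_iff.1 h)
    · exact Or.inr (Or.inl (SimpleGraph.dist_eq_one_iff_adj.1 h))
    · exact Or.inr (Or.inr rfl)
  by_cases hex : ∃ u v, G.dist u v = 2
  · obtain ⟨u, v, huv⟩ := hex
    obtain ⟨w, huw, hvw, hw⟩ := hG u v huv
    refine hits_ne_nil_of_card_le hs hc w u v fun M hM hMc hMw hMu hMv y => ?_
    have hne : ∀ {x y}, G.Adj x y → c x ≠ c y := fun h => hc.1 _ _ ((hA _ _).2 h)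
    -- A neighbour of `w` other than `u`, `v` loses the colour of `w` and that of `u` or `v`; these
    -- differ, so one of three colours remains.
    have hN : ∀ x, G.Adj w x → M x = {c x} := by
      intro x hx
      by_cases hxu : x = u
      · rw [hxu, hMu]
      by_cases hxv : x = v
      · rw [hxv, hMv]
      have h1 := hM.notMem ((hA _ _).2 hx) hMw
      rcases hw x hx hxu hxv with h | h
      · exact eq_singleton_of_notMem (hMc.2 x) (hne huw) (hM.notMem ((hA _ _).2 h.symm) hMu) h1
      · exact eq_singleton_of_notMem (hMc.2 x) (hne hvw) (hM.notMem ((hA _ _).2 h.symm) hMv) h1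
    rcases hdist w y with h | h | h
    · simp [← h, hMw]
    · simp [hN y h]
    -- Only the common neighbour is needed here; its forced colour disappears from the list of `y`.
    · obtain ⟨x, hwx, hyx, -⟩ := hG w y h
      exact card_le_two_of_notMem (hM.notMem ((hA _ _).2 hyx.symm) (hN x hwx))
  · rcases Nat.eq_zero_or_pos n with hn | hn
    · subst hn
      exact hits_ne_nil_of_isGood (i := 0) (j := 0) (k := 0) (a := 0) (b := 0) (d := 0) hs
        le_rfl le_rfl le_rfl
        ⟨fun x => x.elim0, fun x => x.elim0, c, fun x => x.elim0, fun x => x.elim0⟩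
    -- The graph is complete, so any vertex will do; it is guessed three times to fit the general
    -- scheme.
    · let w : Fin n := ⟨0, hn⟩
      refine hits_ne_nil_of_card_le hs hc w w w fun M hM _ hMw _ _ y => ?_
      rcases hdist w y with h | h | h
      · simp [← h, hMw]
      · exact card_le_two_of_notMem (hM.notMem ((hA _ _).2 h) hMw)
      · exact absurd ⟨w, y, h⟩ hex

end ListThreeColouring

/-! ### The program -/

namespace ListThreeColouring

open StackProg StackProg.Prog

/-! ### Stacks and register. -/

/-- The names of the stacks. -/
inductive Stack
  | inp | out | adj | adj' | cur | cur' | old | sav | tmp | fuel | acc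
  | lev (i : Fin 4) | cnt (i : Fin 4)
  deriving DecidableEq, Fintype

/-- The alphabets of the stacks. -/
abbrev Stack.Alph : Stack → Type
  | inp => Γ'
  | out | adj | adj' => Bool
  | cur | cur' | old | sav | lev _ => Finset (Fin 3)
  | tmp | fuel | acc | cnt _ => Unit

/-- The register: two lists of colours, two bits, and the state of the parser. -/
structure Reg where
  l : Finset (Fin 3)
  m : Finset (Fin 3)
  b : Bool
  flag : Bool
  phase : Fin 5
  deriving DecidableEq, Fintype

/-- The contents of the stacks. -/
structure Stacks where
  inp : List Γ' := []
  out : List Bool := []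
  adj : List Bool := []
  adj' : List Bool := []
  cur : List (Finset (Fin 3)) := []
  cur' : List (Finset (Fin 3)) := []
  old : List (Finset (Fin 3)) := []
  sav : List (Finset (Fin 3)) := []
  tmp : List Unit := []
  fuel : List Unit := []
  acc : List Unit := []
  lev : Fin 4 → List (Finset (Fin 3)) := fun _ => []
  cnt : Fin 4 → List Unit := fun _ => []

namespace Stacks

/-- The contents of a stack. -/
def get (s : Stacks) : (k : Stack) → List k.Alph
  | .inp => s.inp
  | .out => s.out
  | .adj => s.adj
  | .adj' => s.adj'
  | .cur => s.cur
  | .cur' => s.cur'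
  | .old => s.old
  | .sav => s.sav
  | .tmp => s.tmp
  | .fuel => s.fuel
  | .acc => s.acc
  | .lev i => s.lev i
  | .cnt i => s.cnt i

/-- Replace the contents of a stack. -/
def set (s : Stacks) : (k : Stack) → List k.Alph → Stacks
  | .inp, x => { s with inp := x }
  | .out, x => { s with out := x }
  | .adj, x => { s with adj := x }
  | .adj', x => { s with adj' := x }
  | .cur, x => { s with cur := x }
  | .cur', x => { s with cur' := x }
  | .old, x => { s with old := x }
  | .sav, x => { s with sav := x }
  | .tmp, x => { s with tmp := x }
  | .fuel, x => { s with fuel := x }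
  | .acc, x => { s with acc := x }
  | .lev i, x => { s with lev := Function.update s.lev i x }
  | .cnt i, x => { s with cnt := Function.update s.cnt i x }

/-- This links record updates, which compute definitionally on concrete fields, to the
`Function.update` in `Exec`. -/
theorem get_set (s : Stacks) (k : Stack) (x : List k.Alph) :
    (s.set k x).get = Function.update s.get k x := by
  funext k'
  by_cases h : k' = k
  · subst h
    rw [Function.update_self]
    cases k' <;> simp [set, get]
  · rw [Function.update_of_ne h]
    cases k <;> cases k' <;> first | exact absurd rfl h | rfl | skip
    all_goals
      simp only [set, get]
      rw [Function.update_of_ne]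
      rintro rfl
      exact h rfl

end Stacks

/-! ### Specifications with time bounds. -/

/-- Programs over the stacks. -/
abbrev Program : Type := Prog Stack.Alph Reg

/-- Started with stacks `s` and a register with `R`, the program `p` halts after at most `t` steps
with stacks `s'` and a register with `R'`. -/
def Spec (R : Reg → Prop) (p : Program) (s : Stacks) (R' : Reg → Prop) (s' : Stacks) (t : ℕ) :
    Prop :=
  ∀ v, R v → ∃ v', R' v' ∧ ∃ t' ≤ t, Exec p v s.get v' s'.get t'

/-- The condition that holds for all registers. -/
abbrev Any : Reg → Prop := fun _ => True

namespace Spec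

variable {R R₁ R₂ R₃ : Reg → Prop} {p q : Program} {s s₁ s₂ s₃ : Stacks} {t t₁ t₂ : ℕ}
  {k : Stack}

theorem mono (h : Spec R₁ p s₁ R₂ s₂ t₁) (ht : t₁ ≤ t₂) : Spec R₁ p s₁ R₂ s₂ t₂ := by
  intro v hv
  obtain ⟨v', hv', t', ht', he⟩ := h v hv
  exact ⟨v', hv', t', ht'.trans ht, he⟩

theorem pre (h : Spec R₂ p s₁ R₃ s₂ t) (hR : ∀ v, R₁ v → R₂ v) : Spec R₁ p s₁ R₃ s₂ t :=
  fun v hv => h v (hR v hv)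

theorem post (h : Spec R₁ p s₁ R₂ s₂ t) (hR : ∀ v, R₂ v → R₃ v) : Spec R₁ p s₁ R₃ s₂ t := by
  intro v hv
  obtain ⟨v', hv', he⟩ := h v hv
  exact ⟨v', hR v' hv', he⟩

theorem any (h : Spec R₁ p s₁ R₂ s₂ t) : Spec R₁ p s₁ Any s₂ t :=
  h.post fun _ _ => trivial

theorem push {f : Reg → k.Alph} {x : k.Alph} (hx : ∀ v, R v → f v = x) :
    Spec R (Prog.push k f) s R (s.set k (x :: s.get k)) 1 := by
  intro v hv
  refine ⟨v, hv, 1, le_rfl, ?_⟩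
  rw [Stacks.get_set, ← hx v hv]
  exact Exec.push

theorem pop {f : Reg → Option k.Alph → Reg} (hf : ∀ v, R v → R₂ (f v (s.get k).head?)) :
    Spec R (Prog.pop k f) s R₂ (s.set k (s.get k).tail) 1 := by
  intro v hv
  refine ⟨_, hf v hv, 1, le_rfl, ?_⟩
  rw [Stacks.get_set]
  exact Exec.pop

theorem load {f : Reg → Reg} (hf : ∀ v, R v → R₂ (f v)) : Spec R (Prog.load f) s R₂ s 1 :=
  fun v hv => ⟨_, hf v hv, 1, le_rfl, Exec.load⟩

theorem skip : Spec R Prog.skip s R s 1 :=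
  load fun _ h => h

theorem seq (h₁ : Spec R₁ p s₁ R₂ s₂ t₁) (h₂ : Spec R₂ q s₂ R₃ s₃ t₂) :
    Spec R₁ (p ;; q) s₁ R₃ s₃ (t₁ + t₂) := by
  intro v hv
  obtain ⟨v', hv', t', ht', he⟩ := h₁ v hv
  obtain ⟨v'', hv'', t'', ht'', he'⟩ := h₂ v' hv'
  exact ⟨v'', hv'', _, Nat.add_le_add ht' ht'', he.seq he'⟩

theorem test_true {b : Reg → Bool} (hb : ∀ v, R₁ v → b v = true) (h : Spec R₁ p s₁ R₂ s₂ t) :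
    Spec R₁ (test b p q) s₁ R₂ s₂ (1 + t) := by
  intro v hv
  obtain ⟨v', hv', t', ht', he⟩ := h v hv
  exact ⟨v', hv', _, Nat.add_le_add_left ht' 1, he.test_true (hb v hv)⟩

theorem test_false {b : Reg → Bool} (hb : ∀ v, R₁ v → b v = false) (h : Spec R₁ q s₁ R₂ s₂ t) :
    Spec R₁ (test b p q) s₁ R₂ s₂ (1 + t) := by
  intro v hv
  obtain ⟨v', hv', t', ht', he⟩ := h v hv
  exact ⟨v', hv', _, Nat.add_le_add_left ht' 1, he.test_false (hb v hv)⟩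

theorem loop_nil {f : Reg → k.Alph → Reg} (h : s.get k = []) : Spec R (loop k f p) s R s 1 :=
  fun v hv => ⟨v, hv, 1, le_rfl, Exec.loop_nil h⟩

theorem loop_cons {f : Reg → k.Alph → Reg} {g : k.Alph} {xs : List k.Alph}
    (h : s₁.get k = g :: xs) (hR : ∀ v, R₁ v → R (f v g)) (h₁ : Spec R p (s₁.set k xs) R₂ s₂ t₁)
    (h₂ : Spec R₂ (loop k f p) s₂ R₃ s₃ t₂) :
    Spec R₁ (loop k f p) s₁ R₃ s₃ (1 + (t₁ + t₂)) := by
  intro v hv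
  obtain ⟨v', hv', t', ht', he⟩ := h₁ (f v g) (hR v hv)
  obtain ⟨v'', hv'', t'', ht'', he'⟩ := h₂ v' hv'
  rw [Stacks.get_set] at he
  exact ⟨v'', hv'', _, Nat.add_le_add_left (Nat.add_le_add ht' ht'') 1, he.loop_cons h he'⟩

/-- A loop with an invariant `I`, `R` that depends on the list of the symbols that were popped
already and on the list of those that are left. -/
theorem loop {f : Reg → k.Alph → Reg} (I : List k.Alph → List k.Alph → Stacks)
    (R : List k.Alph → List k.Alph → Reg → Prop) (hI : ∀ d u, (I d u).get k = u)
    (h : ∀ d g u, Spec (fun w => ∃ v, R d (g :: u) v ∧ w = f v g) p ((I d (g :: u)).set k u)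
      (R (g :: d) u) (I (g :: d) u) t) (xs : List k.Alph) :
    Spec (R [] xs) (Prog.loop k f p) (I [] xs) (R xs.reverse []) (I xs.reverse [])
      (xs.length * (t + 1) + 1) := by
  -- The induction needs an arbitrary history `d`, which grows in reverse order of popping.
  suffices ∀ d, Spec (R d xs) (Prog.loop k f p) (I d xs) (R (xs.reverse ++ d) [])
      (I (xs.reverse ++ d) []) (xs.length * (t + 1) + 1) by simpa using this []
  induction xs with
  | nil => exact fun d => (loop_nil (hI _ _)).mono (by simp)
  | cons g xs ih =>
    intro d
    have h₂ := ih (g :: d)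
    rw [← List.singleton_append, ← List.append_assoc, ← List.reverse_cons] at h₂
    refine (loop_cons (hI _ _) (fun v hv => ⟨v, hv, rfl⟩) (h d g xs) h₂).mono (le_of_eq ?_)
    rw [List.length_cons]
    ring

/-- A loop with an invariant that does not mention the register. -/
theorem loop_any {f : Reg → k.Alph → Reg} (I : List k.Alph → List k.Alph → Stacks)
    (hI : ∀ d u, (I d u).get k = u)
    (h : ∀ d g u, Spec (fun w => ∃ v, w = f v g) p ((I d (g :: u)).set k u) Any (I (g :: d) u) t)
    (xs : List k.Alph) :
    Spec Any (Prog.loop k f p) (I [] xs) Any (I xs.reverse []) (xs.length * (t + 1) + 1) :=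
  loop I (fun _ _ => Any) hI
    (fun d g u => (h d g u).pre fun _ ⟨v, _, hv⟩ => ⟨v, hv⟩) xs

end Spec

/-! ### The programs for the steps of the algorithm. -/

/-- Empty the stack `cur'` onto `cur`. -/
def back : Program :=
  loop .cur' (fun v m => { v with m := m }) (push .cur fun v => v.m)

/-- Copy `cur` to `old`. -/
def copyToOld : Program :=
  loop .cur (fun v m => { v with m := m }) (push .cur' fun v => v.m) ;;
  loop .cur' (fun v m => { v with m := m }) (push .cur (fun v => v.m) ;; push .old fun v => v.m)

/-- Process a row of the adjacency matrix in a round of propagation. -/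
def processRow : Program :=
  loop .cur (fun v m => { v with m := m })
    (pop .adj (fun v o => { v with b := o.getD false }) ;;
      push .adj' (fun v => v.b) ;;
      push .cur' fun v => restrict v.b v.l v.m)

/-- Process all rows of the adjacency matrix in a round of propagation. -/
def processRows : Program :=
  loop .old (fun v l => { v with l := l }) (processRow ;; back)

/-- Empty the stack `adj'` onto `adj`. -/
def restoreAdj : Program :=
  loop .adj' (fun v b => { v with b := b }) (push .adj fun v => v.b)

/-- A round of propagation in `cur`. -/
def passProg : Program :=
  copyToOld ;; processRows ;; restoreAdj

/-- Propagation in `cur`. -/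
def propagateProg : Program :=
  loop .cur (fun v m => { v with m := m })
    (push .cur' (fun v => v.m) ;; push .fuel (fun _ => ()) ;; push .fuel (fun _ => ()) ;;
      push .fuel fun _ => ()) ;;
  back ;;
  loop .fuel (fun v _ => v) passProg

/-- Copy the level `i` to `cur` up to the position given by `cnt i`. -/
def copyPrefix (i : Fin 4) : Program :=
  loop (.cnt i) (fun v _ => v)
    (pop (.lev i) (fun v o => { v with m := o.getD ∅ }) ;; push .sav (fun v => v.m) ;;
      push .cur' (fun v => v.m) ;; push .tmp fun _ => ())

/-- Copy the rest of the level `i` to `cur`; the first list is restricted to the colour `a`. -/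
def copySuffix (i : Fin 4) (a : Fin 3) : Program :=
  loop (.lev i) (fun v m => { v with m := m })
    (push .sav (fun v => v.m) ;; push .cur' (fun v => if v.flag then v.m ∩ {a} else v.m) ;;
      load fun v => { v with flag := false })

/-- Copy the level `i` to `cur` and assign the colour `a` to the vertex at the position given by
`cnt i`. -/
def assignProg (i : Fin 4) (a : Fin 3) : Program :=
  copyPrefix i ;; load (fun v => { v with flag := true }) ;; copySuffix i a ;;
  loop .sav (fun v m => { v with m := m }) (push (.lev i) fun v => v.m) ;;
  back ;;
  loop .tmp (fun v _ => v) (push (.cnt i) fun _ => ())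

/-- Assign the colour `a` to the vertex at the position given by `cnt i` and propagate. -/
def decideProg (i : Fin 4) (a : Fin 3) : Program :=
  assignProg i a ;; propagateProg

/-- Set `cnt i` to the number of vertices plus one. -/
def initCount (i : Fin 4) : Program :=
  loop (.lev i) (fun v m => { v with m := m }) (push .cur' (fun v => v.m) ;;
    push (.cnt i) fun _ => ()) ;;
  loop .cur' (fun v m => { v with m := m }) (push (.lev i) fun v => v.m) ;;
  push (.cnt i) fun _ => ()

/-- The program for `tryAt`. -/
def tryProg (a : Fin 3) : Program :=
  decideProg 0 a ;; load (fun v => { v with flag := true }) ;;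
  loop .cur (fun v m => { v with m := m, flag := v.flag && decide (m ≠ ∅) })
    (push .cur' fun v => v.m) ;;
  test (fun v => v.flag)
    (loop (.lev 0) (fun v _ => v) skip ;;
      loop .cur' (fun v m => { v with m := m }) (push (.lev 0) fun v => v.m))
    (loop .cur' (fun v _ => v) skip)

/-- The program for `greedyHits`. -/
def greedyProg : Program :=
  initCount 0 ;;
  loop (.cnt 0) (fun v _ => v) (tryProg 0 ;; tryProg 1 ;; tryProg 2) ;;
  load (fun v => { v with flag := true }) ;;
  loop (.lev 0) (fun v m => { v with flag := v.flag && decide (m.card = 1) }) skip ;;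
  test (fun v => v.flag) (push .acc fun _ => ()) skip

/-- Make a decision on level `i`, put the result on level `j` and run `p`. -/
def branchProg (i j : Fin 4) (p : Program) (a : Fin 3) : Program :=
  decideProg i a ;;
  loop .cur (fun v m => { v with m := m }) (push .cur' fun v => v.m) ;;
  loop .cur' (fun v m => { v with m := m }) (push (.lev j) fun v => v.m) ;;
  p

/-- The program for `guess`. -/
def guessProg (i j : Fin 4) (p : Program) : Program :=
  initCount i ;;
  loop (.cnt i) (fun v _ => v) (branchProg i j p 0 ;; branchProg i j p 1 ;; branchProg i j p 2) ;;
  loop (.lev i) (fun v _ => v) skip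

/-- Read a symbol of the input. -/
def readSymbol (v : Reg) : Γ' → Reg
  | .comma => { v with phase := 0, l := ∅ }
  | .bit b =>
    if v.phase = 0 then { v with phase := 1, l := if b then insert 0 v.l else v.l }
    else if v.phase = 1 then { v with phase := 2, l := if b then insert 1 v.l else v.l }
    else if v.phase = 2 then { v with phase := 3, l := if b then insert 2 v.l else v.l }
    else { v with phase := 4, b := b }
  | _ => v

/-- Read the input. -/
def parseProg : Program :=
  loop .inp readSymbol
    (test (fun v => decide (v.phase = 4)) (push .adj' fun v => v.b)
      (test (fun v => decide (v.phase = 3)) (push .cur' fun v => v.l) skip))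

/-- The initial register. -/
def initReg : Reg := ⟨∅, ∅, false, false, 0⟩

/-- The whole program. -/
def mainProg : Program :=
  parseProg ;; restoreAdj ;;
  loop .cur' (fun v m => { v with m := m }) (push (.lev 3) fun v => v.m) ;;
  guessProg 3 2 (guessProg 2 1 (guessProg 1 0 greedyProg)) ;;
  loop .adj (fun v _ => v) skip ;;
  load (fun v => { v with flag := false }) ;;
  loop .acc (fun v _ => { v with flag := true }) skip ;;
  push .out (fun v => v.flag) ;;
  load fun _ => initReg

end ListThreeColouring

/-! ### Correctness and running time of the program -/

namespace ListThreeColouring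

open StackProg StackProg.Prog

variable {n : ℕ} {A : Fin n → Fin n → Bool}

/-! ### Propagation on the stacks. -/

theorem back_spec (s : Stacks) :
    Spec Any back s Any { s with cur := s.cur'.reverse ++ s.cur, cur' := [] }
      (s.cur'.length * 2 + 1) :=
  Spec.loop_any (k := .cur') (fun d u => { s with cur := d ++ s.cur, cur' := u }) (fun _ _ => rfl)
    (fun _ g _ => Spec.any (Spec.push (k := .cur) (x := g) (by rintro _ ⟨v, rfl⟩; rfl))) s.cur'

theorem restoreAdj_spec (s : Stacks) :
    Spec Any restoreAdj s Any { s with adj := s.adj'.reverse ++ s.adj, adj' := [] }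
      (s.adj'.length * 2 + 1) :=
  Spec.loop_any (k := .adj') (fun d u => { s with adj := d ++ s.adj, adj' := u }) (fun _ _ => rfl)
    (fun _ g _ => Spec.any (Spec.push (k := .adj) (x := g) (by rintro _ ⟨v, rfl⟩; rfl))) s.adj'

/-- Moving a stack reverses it, so the copy is made on the way back from `cur'`. -/
theorem copyToOld_spec (s : Stacks) (h : s.cur' = []) :
    Spec Any copyToOld s Any { s with old := s.cur ++ s.old }
      ((s.cur.length * 2 + 1) + (s.cur.length * 3 + 1)) := by
  have h₁ := Spec.loop_any (k := .cur) (f := fun v m => { v with m := m })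
    (p := push .cur' fun v => v.m)
    (fun d u => { s with cur := u, cur' := d }) (fun _ _ => rfl)
    (fun _ g _ => Spec.any (Spec.push (k := .cur') (x := g) (by rintro _ ⟨v, rfl⟩; rfl))) s.cur
  have h₂ := Spec.loop_any (k := .cur') (f := fun v m => { v with m := m })
    (p := push .cur (fun v => v.m) ;; push .old fun v => v.m)
    (fun d u => { s with cur := d, cur' := u, old := d ++ s.old }) (fun _ _ => rfl)
    (fun _ g _ => Spec.any
      ((Spec.push (k := .cur) (x := g) (by rintro _ ⟨v, rfl⟩; rfl)).seq
        (Spec.push (k := .old) (x := g) (by rintro _ ⟨v, rfl⟩; rfl)))) s.cur.reverse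
  rw [List.reverse_reverse, List.length_reverse] at h₂
  -- With the record split and the hypotheses substituted, the stacks agree definitionally.
  obtain ⟨⟩ := s
  obtain rfl := h
  exact h₁.seq h₂

/-- One row is consumed in lockstep with `cur`, while the register keeps the list `l` of the vertex
of that row; `rest` holds the rows still to come. -/
theorem processRow_spec (l : Finset (Fin 3)) (ms : List (Finset (Fin 3))) (bits : List Bool)
    (hl : bits.length = ms.length) (rest : List Bool) (s : Stacks) (hs : s.cur = ms)
    (ha : s.adj = bits ++ rest) :
    Spec (fun v => v.l = l) processRow s (fun v => v.l = l)
      { s with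
        cur := []
        adj := rest
        adj' := bits.reverse ++ s.adj'
        cur' := (List.zipWith (fun b m => restrict b l m) bits ms).reverse ++ s.cur' }
      (ms.length * 4 + 1) := by
  induction ms generalizing bits s with
  | nil =>
    obtain rfl := List.length_eq_zero_iff.1 hl
    obtain ⟨⟩ := s
    obtain rfl := hs
    obtain rfl := ha
    exact (Spec.loop_nil rfl).mono (by simp)
  | cons m ms ih =>
    obtain ⟨b, bits, rfl⟩ := List.exists_cons_of_length_eq_add_one hl
    have h := ih bits (by simpa using hl)
      { s with
        cur := ms
        adj := bits ++ rest
        adj' := b :: s.adj'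
        cur' := restrict b l m :: s.cur' } rfl rfl
    obtain ⟨⟩ := s
    obtain rfl := hs
    obtain rfl := ha
    simp only [List.zipWith_cons_cons, List.reverse_cons, List.append_assoc,
      List.singleton_append]
    refine (Spec.loop_cons (k := .cur) (R := fun v => v.l = l ∧ v.m = m) rfl
      (fun v hv => ⟨hv, rfl⟩) ?_ h).mono (t₁ := 1 + (3 + (ms.length * 4 + 1))) ?_
    · exact (Spec.pop (k := .adj) (R₂ := fun v => v.l = l ∧ v.m = m ∧ v.b = b)
          (fun v hv => ⟨hv.1, hv.2, rfl⟩)).seq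
        ((Spec.push (k := .adj') (x := b) (fun v hv => hv.2.2)).seq
          ((Spec.push (k := .cur') (x := restrict b l m)
            (fun v hv => by rw [hv.1, hv.2.1, hv.2.2])).post fun v hv => hv.1))
    · rw [List.length_cons]
      omega

theorem zipWith_ofFn {α β γ : Type} (f : α → β → γ) (a : Fin n → α) (b : Fin n → β) :
    List.zipWith f (List.ofFn a) (List.ofFn b) = List.ofFn fun i => f (a i) (b i) := by
  apply List.ext_getElem <;> simp

/-- The rows of the adjacency matrix for a list of vertices. -/
def rows (A : Fin n → Fin n → Bool) (xs : List (Fin n)) : List Bool :=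
  xs.flatMap fun x => List.ofFn (A x)

/-- The stack `old` preserves the lists from the start of the round, so `L` stays fixed while `cur`
carries the changing `M`. -/
theorem processRows_spec (L M : Fin n → Finset (Fin 3)) (xs : List (Fin n)) (s : Stacks)
    (ho : s.old = xs.map L) (ha : s.adj = rows A xs) (hc : s.cur = List.ofFn M)
    (hc' : s.cur' = []) :
    Spec Any processRows s Any
      { s with
        old := []
        adj := []
        adj' := (rows A xs).reverse ++ s.adj'
        cur := List.ofFn (xs.foldl (fun M x y => restrict (A x y) (L x) (M y)) M) }
      (xs.length * ((n * 4 + 1) + (n * 2 + 1) + 1) + 1) := by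
  induction xs generalizing M s with
  | nil =>
    obtain ⟨⟩ := s
    obtain rfl := ho
    obtain rfl := ha
    obtain rfl := hc
    exact (Spec.loop_nil rfl).mono (by simp)
  | cons x xs ih =>
    have h₁ := processRow_spec (L x) (List.ofFn M) (List.ofFn (A x)) (by simp) (rows A xs)
      { s with old := xs.map L, adj' := s.adj' } hc ha
    have h₂ := back_spec
      { s with
        old := xs.map L
        cur := []
        adj := rows A xs
        adj' := (List.ofFn (A x)).reverse ++ s.adj'
        cur' := (List.ofFn fun y => restrict (A x y) (L x) (M y)).reverse }
    have h₃ := ih (fun y => restrict (A x y) (L x) (M y))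
      { s with
        old := xs.map L
        cur := List.ofFn fun y => restrict (A x y) (L x) (M y)
        adj := rows A xs
        adj' := (List.ofFn (A x)).reverse ++ s.adj'
        cur' := [] } rfl rfl rfl rfl
    obtain ⟨⟩ := s
    obtain rfl := ho
    obtain rfl := ha
    obtain rfl := hc
    obtain rfl := hc'
    simp only [zipWith_ofFn, List.append_nil, List.reverse_reverse, List.length_reverse,
      List.length_ofFn] at h₁ h₂
    have h₄ := h₁.seq (h₂.pre fun _ _ => trivial)
    simp only [rows, List.flatMap_cons, List.reverse_append, List.append_assoc,
      List.foldl_cons] at h₃ h₄ ⊢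
    refine (Spec.loop_cons (k := .old) (g := L x) (xs := xs.map L) rfl
      (fun v _ => rfl) h₄ h₃).mono (le_of_eq ?_)
    rw [List.length_cons]
    ring

/-- The time for a round of propagation. -/
def passTime (n : ℕ) : ℕ :=
  ((n * 2 + 1) + (n * 3 + 1)) + ((n * ((n * 4 + 1) + (n * 2 + 1) + 1) + 1) + (n * n * 2 + 1))

theorem length_rows (xs : List (Fin n)) : (rows A xs).length = xs.length * n := by
  simp [rows]

theorem passProg_spec (L : Fin n → Finset (Fin 3)) (s : Stacks)
    (ha : s.adj = rows A (List.finRange n)) (ha' : s.adj' = []) (hc : s.cur = List.ofFn L)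
    (hc' : s.cur' = []) (ho : s.old = []) :
    Spec Any passProg s Any { s with cur := List.ofFn (propStep A L) } (passTime n) := by
  have h₁ := copyToOld_spec s hc'
  have h₂ := processRows_spec (A := A) L L (List.finRange n) { s with old := s.cur ++ s.old }
    (by rw [hc, ho, List.append_nil, List.ofFn_eq_map]) ha hc hc'
  have h₃ := restoreAdj_spec
    { s with
      old := []
      adj := []
      adj' := (rows A (List.finRange n)).reverse ++ s.adj'
      cur := List.ofFn (propStep A L) }
  obtain ⟨⟩ := s
  obtain rfl := ha
  obtain rfl := ha'
  obtain rfl := hc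
  obtain rfl := hc'
  obtain rfl := ho
  simp only [List.append_nil, List.reverse_reverse, List.length_reverse, List.length_ofFn,
    length_rows, List.length_finRange] at h₁ h₂ h₃
  exact h₁.seq (h₂.seq h₃)

/-- The stacks between the main steps of the program. -/
abbrev idle (A : Fin n → Fin n → Bool) (c : List (Finset (Fin 3)))
    (lev : Fin 4 → List (Finset (Fin 3))) (cnt : Fin 4 → List Unit) (acc : List Unit) : Stacks :=
  { adj := rows A (List.finRange n), cur := c, lev := lev, cnt := cnt, acc := acc }

/-- The time for propagation. -/
def propagateTime (n : ℕ) : ℕ :=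
  (n * 5 + 1) + ((n * 2 + 1) + (3 * n * (passTime n + 1) + 1))

theorem propagateProg_spec (L : Fin n → Finset (Fin 3)) (lev : Fin 4 → List (Finset (Fin 3)))
    (cnt : Fin 4 → List Unit) (acc : List Unit) :
    Spec Any propagateProg (idle A (List.ofFn L) lev cnt acc) Any
      (idle A (List.ofFn (propagate A L)) lev cnt acc) (propagateTime n) := by
  let s := idle A (List.ofFn L) lev cnt acc
  have h₁ := Spec.loop_any (k := .cur) (f := fun v m => { v with m := m })
    (p := push .cur' (fun v => v.m) ;; push .fuel (fun _ => ()) ;; push .fuel (fun _ => ()) ;;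
      push .fuel fun _ => ())
    (fun d u => { s with cur := u, cur' := d, fuel := d.flatMap fun _ => [(), (), ()] })
    (fun _ _ => rfl)
    (fun _ g _ => Spec.any ((Spec.push (k := .cur') (x := g) (by rintro _ ⟨v, rfl⟩; rfl)).seq
      ((Spec.push (k := .fuel) (x := ()) fun _ _ => rfl).seq
        ((Spec.push (k := .fuel) (x := ()) fun _ _ => rfl).seq
          (Spec.push (k := .fuel) (x := ()) fun _ _ => rfl))))) (List.ofFn L)
  have h₂ := back_spec
    { s with
      cur := []
      cur' := (List.ofFn L).reverse
      fuel := (List.ofFn L).reverse.flatMap fun _ => [(), (), ()] }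
  -- Three units of fuel per vertex give the `3 * n` rounds of `propagate`.
  have h₃ := Spec.loop_any (k := .fuel) (f := fun v _ => v) (p := passProg)
    (fun d u => { s with cur := List.ofFn ((propStep A)^[d.length] L), fuel := u })
    (fun _ _ => rfl)
    (fun d g u => by
      rw [List.length_cons, Function.iterate_succ_apply']
      exact (passProg_spec _ _ rfl rfl rfl rfl rfl).pre fun _ _ => trivial)
    ((List.ofFn L).reverse.flatMap fun _ => [(), (), ()])
  simp only [List.length_reverse, List.reverse_reverse, List.append_nil, List.length_ofFn,
    List.length_flatMap, List.length_cons, List.length_nil, List.map_const',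
    List.sum_replicate, smul_eq_mul] at h₁ h₂ h₃
  have e : n * (0 + 1 + 1 + 1) = 3 * n := by ring
  rw [e] at h₃
  exact h₁.seq (h₂.seq h₃)

/-! ### Assigning a colour at a position given in unary. -/

theorem Spec.to {R R' : Reg → Prop} {p : Program} {s s₁ s₂ : Stacks} {t : ℕ}
    (h : Spec R p s R' s₁ t) (e : s₁ = s₂) : Spec R p s R' s₂ t :=
  e ▸ h

/-- The counter is spent on passing over `P`; `tmp` records the units from which it is restored
later. -/
theorem copyPrefix_spec (i : Fin 4) (P Q : List (Finset (Fin 3))) (s : Stacks)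
    (hc : s.cnt i = List.replicate P.length ()) (hl : s.lev i = P ++ Q) :
    Spec Any (copyPrefix i) s Any
      { s with
        cnt := Function.update s.cnt i []
        lev := Function.update s.lev i Q
        tmp := List.replicate P.length () ++ s.tmp
        sav := P.reverse ++ s.sav
        cur' := P.reverse ++ s.cur' }
      (P.length * 5 + 1) := by
  induction P generalizing s with
  | nil =>
    refine (Spec.loop_nil (k := .cnt i) hc).to ?_ |>.mono (by simp)
    have h₁ : Function.update s.cnt i [] = s.cnt := by
      rw [show [] = s.cnt i from hc.symm, Function.update_eq_self]
    have h₂ : Function.update s.lev i Q = s.lev := by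
      rw [show Q = s.lev i from hl.symm, Function.update_eq_self]
    rw [h₁, h₂]
    rfl
  | cons m P ih =>
    have hp := Spec.pop (k := .lev i) (R := Any) (R₂ := fun v => v.m = m)
      (s := { s with cnt := Function.update s.cnt i (List.replicate P.length ()) })
      (f := fun v o => { v with m := o.getD ∅ })
      (fun v _ => by
        change (s.lev i).head?.getD ∅ = m
        rw [hl]
        rfl)
    have hp' := hp.to (s₂ := { s with
        cnt := Function.update s.cnt i (List.replicate P.length ())
        lev := Function.update s.lev i (P ++ Q) }) (by simp [Stacks.set, Stacks.get, hl])
    have hb := hp'.seq ((Spec.push (k := .sav) (x := m) fun v hv => hv).seq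
      ((Spec.push (k := .cur') (x := m) fun v hv => hv).seq
        (Spec.push (k := .tmp) (f := fun _ => ()) (x := ()) fun v hv => rfl).any))
    have h := ih
      { s with
        cnt := Function.update s.cnt i (List.replicate P.length ())
        lev := Function.update s.lev i (P ++ Q)
        tmp := () :: s.tmp
        sav := m :: s.sav
        cur' := m :: s.cur' } (by simp) (by simp)
    refine ((Spec.loop_cons (k := .cnt i) hc (fun _ _ => trivial) hb h).to ?_).mono ?_
    · simp [List.replicate_succ']
    · rw [List.length_cons]
      omega

theorem copySuffix_spec_of_flag_eq_false (i : Fin 4) (a : Fin 3) (s : Stacks) :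
    Spec (fun v => v.flag = false) (copySuffix i a) s Any
      { s with
        lev := Function.update s.lev i []
        sav := (s.lev i).reverse ++ s.sav
        cur' := (s.lev i).reverse ++ s.cur' }
      ((s.lev i).length * 4 + 1) := by
  have h := Spec.loop (k := .lev i) (f := fun v m => { v with m := m })
    (p := push .sav (fun v => v.m) ;; push .cur' (fun v => if v.flag then v.m ∩ {a} else v.m) ;;
      load fun v => { v with flag := false })
    (fun d u => { s with
      lev := Function.update s.lev i u
      sav := d ++ s.sav
      cur' := d ++ s.cur' })
    (fun _ _ v => v.flag = false) (fun _ _ => Function.update_self ..)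
    (fun d g u => by
      refine Spec.to ((Spec.push (k := .sav) (x := g) ?_).seq
        ((Spec.push (k := .cur') (x := g) ?_).seq (Spec.load fun _ _ => rfl))) ?_
      · rintro _ ⟨v, -, rfl⟩
        rfl
      · rintro _ ⟨v, hv, rfl⟩
        exact if_neg (by simp [hv])
      · simp [Stacks.set, Stacks.get]) (s.lev i)
  rw [Function.update_eq_self] at h
  exact h.any

/-- Only the first list meets a raised flag. An empty suffix corresponds to the dummy position `n`.
-/
theorem copySuffix_spec (i : Fin 4) (a : Fin 3) (s : Stacks) :
    Spec (fun v => v.flag = true) (copySuffix i a) s Any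
      { s with
        lev := Function.update s.lev i []
        sav := (s.lev i).reverse ++ s.sav
        cur' := ((s.lev i).modifyHead (· ∩ {a})).reverse ++ s.cur' }
      ((s.lev i).length * 4 + 1) := by
  rcases hl : s.lev i with - | ⟨m, Q⟩
  · refine (Spec.loop_nil (k := .lev i) hl).any.to ?_ |>.mono (by simp)
    rw [show Function.update s.lev i [] = s.lev by rw [← hl, Function.update_eq_self]]
    rfl
  · have h := copySuffix_spec_of_flag_eq_false i a
      { s with
        lev := Function.update s.lev i Q
        sav := m :: s.sav
        cur' := (m ∩ {a}) :: s.cur' }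
    have hb : Spec (fun v => v.flag = true ∧ v.m = m) _ _ _ _ _ :=
      (Spec.push (k := .sav) (s := s.set (.lev i) Q) (f := fun v => v.m) (x := m)
        fun v hv => hv.2).seq
        ((Spec.push (k := .cur') (f := fun v => if v.flag then v.m ∩ {a} else v.m)
          (x := m ∩ {a}) fun v hv => by rw [if_pos hv.1, hv.2]).seq
          (Spec.load (R₂ := fun v => v.flag = false) (f := fun v => { v with flag := false })
            fun _ _ => rfl))
    refine ((Spec.loop_cons (k := .lev i) hl (fun v hv => ⟨hv, rfl⟩) hb h).to ?_).mono ?_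
    · simp
    · simp only [Function.update_self, List.length_cons]
      omega

theorem sav_to_lev_spec (i : Fin 4) (s : Stacks) (hs : s.lev i = []) :
    Spec Any (loop .sav (fun v m => { v with m := m }) (push (.lev i) fun v => v.m)) s Any
      { s with sav := [], lev := Function.update s.lev i s.sav.reverse }
      (s.sav.length * 2 + 1) := by
  have h := Spec.loop_any (k := .sav) (f := fun v m => { v with m := m })
    (p := push (.lev i) fun v => v.m)
    (fun d u => { s with sav := u, lev := Function.update s.lev i d }) (fun _ _ => rfl)
    (fun d g u => (Spec.any (Spec.push (k := .lev i) (x := g) (by rintro _ ⟨v, rfl⟩; rfl))).to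
      (by simp [Stacks.set, Stacks.get])) s.sav
  rw [show Function.update s.lev i [] = s.lev by rw [← hs, Function.update_eq_self]] at h
  exact h

theorem cur'_to_lev_spec (i : Fin 4) (s : Stacks) (hs : s.lev i = []) :
    Spec Any (loop .cur' (fun v m => { v with m := m }) (push (.lev i) fun v => v.m)) s Any
      { s with cur' := [], lev := Function.update s.lev i s.cur'.reverse }
      (s.cur'.length * 2 + 1) := by
  have h := Spec.loop_any (k := .cur') (f := fun v m => { v with m := m })
    (p := push (.lev i) fun v => v.m)
    (fun d u => { s with cur' := u, lev := Function.update s.lev i d }) (fun _ _ => rfl)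
    (fun d g u => (Spec.any (Spec.push (k := .lev i) (x := g) (by rintro _ ⟨v, rfl⟩; rfl))).to
      (by simp [Stacks.set, Stacks.get])) s.cur'
  rw [show Function.update s.lev i [] = s.lev by rw [← hs, Function.update_eq_self]] at h
  exact h

theorem tmp_to_cnt_spec (i : Fin 4) (s : Stacks) (hs : s.cnt i = []) :
    Spec Any (loop .tmp (fun v _ => v) (push (.cnt i) fun _ => ())) s Any
      { s with tmp := [], cnt := Function.update s.cnt i s.tmp.reverse }
      (s.tmp.length * 2 + 1) := by
  have h := Spec.loop_any (k := .tmp) (f := fun v _ => v)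
    (p := push (.cnt i) fun _ => ())
    (fun d u => { s with tmp := u, cnt := Function.update s.cnt i d }) (fun _ _ => rfl)
    (fun d g u => (Spec.any (Spec.push (k := .cnt i) (x := g) (fun _ _ => rfl))).to
      (by simp [Stacks.set, Stacks.get])) s.tmp
  rw [show Function.update s.cnt i [] = s.cnt by rw [← hs, Function.update_eq_self]] at h
  exact h

theorem take_append_modifyHead_drop (j : ℕ) (a : Fin 3) (L : Fin n → Finset (Fin 3)) :
    (List.ofFn L).take j ++ ((List.ofFn L).drop j).modifyHead (· ∩ {a}) =
      List.ofFn (assign j a L) := by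
  rw [← List.modify_eq_take_drop]
  apply List.ext_getElem
  · simp
  · intro k h₁ h₂
    simp [List.getElem_modify, assign, eq_comm]

theorem assignProg_spec (i : Fin 4) (a : Fin 3) {j : ℕ} (hj : j ≤ n)
    (L : Fin n → Finset (Fin 3)) (lev : Fin 4 → List (Finset (Fin 3))) (cnt : Fin 4 → List Unit)
    (acc : List Unit) (hl : lev i = List.ofFn L) (hc : cnt i = List.replicate j ()) :
    Spec Any (assignProg i a) (idle A [] lev cnt acc) Any
      (idle A (List.ofFn (assign j a L)) lev cnt acc) (n * 15 + 6) := by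
  -- This is where `j ≤ n` enters: the counter must not outrun the list.
  have hlen : ((List.ofFn L).take j).length = j := by simpa using hj
  have h₁ := copyPrefix_spec i ((List.ofFn L).take j) ((List.ofFn L).drop j)
    (idle A [] lev cnt acc) (by rw [hlen, ← hc]) (by rw [List.take_append_drop, ← hl])
  have h₂ := copySuffix_spec i a
    { idle A [] lev cnt acc with
      cnt := Function.update cnt i []
      lev := Function.update lev i ((List.ofFn L).drop j)
      tmp := List.replicate j ()
      sav := ((List.ofFn L).take j).reverse
      cur' := ((List.ofFn L).take j).reverse }
  have h₃ := sav_to_lev_spec i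
    { idle A [] lev cnt acc with
      cnt := Function.update cnt i []
      lev := Function.update lev i []
      tmp := List.replicate j ()
      sav := (List.ofFn L).reverse
      cur' := (List.ofFn (assign j a L)).reverse } (by simp)
  have h₄ := back_spec
    { idle A [] lev cnt acc with
      cnt := Function.update cnt i []
      tmp := List.replicate j ()
      cur' := (List.ofFn (assign j a L)).reverse }
  have h₅ := tmp_to_cnt_spec i
    { idle A (List.ofFn (assign j a L)) lev cnt acc with
      cnt := Function.update cnt i []
      tmp := List.replicate j () } (by simp)
  have hl' : Function.update lev i (List.ofFn L) = lev := by rw [← hl, Function.update_eq_self]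
  have hc' : Function.update cnt i (List.replicate j ()) = cnt := by
    rw [← hc, Function.update_eq_self]
  simp only [hlen, List.append_nil, Function.update_self, Function.update_idem,
    ← List.reverse_append, List.take_append_drop, take_append_modifyHead_drop,
    List.reverse_reverse, List.length_reverse, List.length_ofFn, List.length_replicate,
    List.reverse_replicate, hl', hc', List.length_drop] at h₁ h₂ h₃ h₄ h₅
  refine (h₁.seq ((Spec.load (R₂ := fun v => v.flag = true) fun _ _ => rfl).seq (h₂.seq (h₃.seq (h₄.seq h₅))))).mono ?_
  omega

/-- The time for a decision. -/
def decideTime (n : ℕ) : ℕ := (n * 15 + 6) + propagateTime n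

theorem decideProg_spec (i : Fin 4) (a : Fin 3) {j : ℕ} (hj : j ≤ n)
    (L : Fin n → Finset (Fin 3)) (lev : Fin 4 → List (Finset (Fin 3))) (cnt : Fin 4 → List Unit)
    (acc : List Unit) (hl : lev i = List.ofFn L) (hc : cnt i = List.replicate j ()) :
    Spec Any (decideProg i a) (idle A [] lev cnt acc) Any
      (idle A (List.ofFn (decideAt A j a L)) lev cnt acc) (decideTime n) :=
  (assignProg_spec i a hj L lev cnt acc hl hc).seq (propagateProg_spec _ lev cnt acc)

/-! ### Counting the vertices, trying colours, and the greedy procedure. -/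

theorem initCount_spec (i : Fin 4) (L : Fin n → Finset (Fin 3))
    (lev : Fin 4 → List (Finset (Fin 3))) (cnt : Fin 4 → List Unit)
    (acc : List Unit) (hl : lev i = List.ofFn L) (hc : cnt i = []) :
    Spec Any (initCount i) (idle A [] lev cnt acc) Any
      (idle A [] lev (Function.update cnt i (List.replicate (n + 1) ())) acc)
      ((n * 3 + 1) + ((n * 2 + 1) + 1)) := by
  have hl' : Function.update lev i (List.ofFn L) = lev := by rw [← hl, Function.update_eq_self]
  have hc' : Function.update cnt i [] = cnt := by rw [← hc, Function.update_eq_self]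
  let s := idle A [] lev cnt acc
  have h₁ := Spec.loop_any (k := .lev i) (f := fun v m => { v with m := m })
    (p := push .cur' (fun v => v.m) ;; push (.cnt i) fun _ => ())
    (fun d u => { s with
      lev := Function.update lev i u
      cur' := d
      cnt := Function.update cnt i (List.replicate d.length ()) })
    (fun _ _ => Function.update_self ..)
    (fun d g u => (Spec.any ((Spec.push (k := .cur') (x := g) (by rintro _ ⟨v, rfl⟩; rfl)).seq
        (Spec.push (k := .cnt i) (x := ()) fun _ _ => rfl))).to
      (by simp [Stacks.set, Stacks.get, List.replicate_succ])) (List.ofFn L)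
  have h₂ := cur'_to_lev_spec i
    { s with
      lev := Function.update lev i []
      cur' := (List.ofFn L).reverse
      cnt := Function.update cnt i (List.replicate n ()) } (by simp)
  have h₃ := (Spec.push (R := Any) (k := .cnt i) (f := fun _ => ()) (x := ())
    (s := { s with cnt := Function.update cnt i (List.replicate n ()) }) fun _ _ => rfl).to
    (s₂ := { s with cnt := Function.update cnt i (List.replicate (n + 1) ()) })
    (by simp [Stacks.set, Stacks.get, List.replicate_succ])
  simp only [Function.update_idem, List.reverse_reverse, List.length_reverse, List.length_ofFn,
    List.length_nil, List.replicate_zero, hl', hc'] at h₁ h₂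
  exact h₁.seq (h₂.seq h₃)

theorem clear_lev_spec (i : Fin 4) (s : Stacks) :
    Spec Any (loop (.lev i) (fun v _ => v) skip) s Any
      { s with lev := Function.update s.lev i [] } ((s.lev i).length * 2 + 1) := by
  have h := Spec.loop_any (k := .lev i) (f := fun v _ => v) (p := skip)
    (fun _ u => { s with lev := Function.update s.lev i u })
    (fun _ _ => Function.update_self ..)
    (fun d g u => Spec.skip.any.to (by simp [Stacks.set])) (s.lev i)
  rw [Function.update_eq_self] at h
  exact h

theorem clear_cur'_spec (s : Stacks) :
    Spec Any (loop .cur' (fun v _ => v) skip) s Any { s with cur' := [] }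
      (s.cur'.length * 2 + 1) :=
  Spec.loop_any (k := .cur') (f := fun v _ => v) (p := skip)
    (fun _ u => { s with cur' := u }) (fun _ _ => rfl) (fun _ _ _ => Spec.skip.any) s.cur'

/-- The time for trying a decision. -/
def tryTime (n : ℕ) : ℕ :=
  decideTime n + (1 + ((n * 2 + 1) + (1 + ((n * 2 + 1) + (n * 2 + 1)))))

theorem tryProg_spec (a : Fin 3) {j : ℕ} (hj : j ≤ n)
    (L : Fin n → Finset (Fin 3)) (lev : Fin 4 → List (Finset (Fin 3))) (cnt : Fin 4 → List Unit)
    (acc : List Unit) (hl : lev 0 = List.ofFn L) (hc : cnt 0 = List.replicate j ()) :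
    Spec Any (tryProg a) (idle A [] lev cnt acc) Any
      (idle A [] (Function.update lev 0 (List.ofFn (tryAt A j a L))) cnt acc) (tryTime n) := by
  have h₁ := decideProg_spec (A := A) 0 a hj L lev cnt acc hl hc
  have h₂ := Spec.loop (k := .cur)
    (f := fun v m => { v with m := m, flag := v.flag && decide (m ≠ ∅) })
    (p := push .cur' fun v => v.m)
    (fun d u => { idle A [] lev cnt acc with cur := u, cur' := d })
    (fun d _ v => v.flag = d.all fun m => decide (m ≠ ∅)) (fun _ _ => rfl)
    (fun d g u => ((Spec.push (k := .cur') (x := g)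
      (R := fun v => v.m = g ∧ v.flag = (g :: d).all fun m => decide (m ≠ ∅))
      fun v hv => hv.1).post fun v hv => hv.2).pre (by
        rintro _ ⟨v, hv, rfl⟩
        simp only [hv, List.all_cons, Bool.and_comm, and_self])) (List.ofFn (decideAt A j a L))
  rw [List.length_ofFn] at h₂
  refine h₁.seq ((Spec.load (R₂ := fun v => v.flag = true) fun _ _ => rfl).seq (h₂.seq ?_))
  by_cases hne : ∀ y, decideAt A j a L y ≠ ∅
  · refine Spec.test_true (fun v hv => hv.trans (by simpa using hne)) ?_
    have h₃ := clear_lev_spec 0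
      { idle A [] lev cnt acc with cur' := (List.ofFn (decideAt A j a L)).reverse }
    have h₄ := cur'_to_lev_spec 0
      { idle A [] lev cnt acc with
        lev := Function.update lev 0 []
        cur' := (List.ofFn (decideAt A j a L)).reverse } (by simp)
    simp only [hl, Function.update_idem, List.reverse_reverse, List.length_reverse,
      List.length_ofFn] at h₃ h₄
    rw [tryAt, if_pos hne]
    exact (h₃.seq h₄).pre fun _ _ => trivial
  · refine Spec.test_false (fun v hv => hv.trans (by simpa using hne)) ?_
    have h₃ := clear_cur'_spec
      { idle A [] lev cnt acc with cur' := (List.ofFn (decideAt A j a L)).reverse }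
    rw [tryAt, if_neg hne, ← hl, Function.update_eq_self]
    refine (h₃.pre fun _ _ => trivial).mono ?_
    simp

/-- A loop pops before running its body, so of `m + 1` units the body sees `m`, exactly the position
treated by `greedy` at `m + 1`. -/
theorem tryAll_loop_spec (m : ℕ) (hm : m ≤ n + 1) (L : Fin n → Finset (Fin 3))
    (lev : Fin 4 → List (Finset (Fin 3))) (cnt : Fin 4 → List Unit) (acc : List Unit)
    (hl : lev 0 = List.ofFn L) :
    Spec Any (loop (.cnt 0) (fun v _ => v) (tryProg 0 ;; tryProg 1 ;; tryProg 2))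
      (idle A [] lev (Function.update cnt 0 (List.replicate m ())) acc) Any
      (idle A [] (Function.update lev 0 (List.ofFn (greedy A m L)))
        (Function.update cnt 0 []) acc)
      (m * ((tryTime n + (tryTime n + tryTime n)) + 1) + 1) := by
  induction m generalizing L lev with
  | zero =>
    refine (Spec.loop_nil (by simp [Stacks.get])).to ?_ |>.mono (by simp)
    rw [greedy, ← hl, Function.update_eq_self]
    rfl
  | succ m ih =>
    have hm' : m ≤ n := Nat.le_of_succ_le_succ hm
    have h₁ := tryProg_spec (A := A) 0 hm' L lev (Function.update cnt 0 (List.replicate m ())) acc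
      hl (Function.update_self ..)
    have h₂ := tryProg_spec (A := A) 1 hm' (tryAt A m 0 L)
      (Function.update lev 0 (List.ofFn (tryAt A m 0 L)))
      (Function.update cnt 0 (List.replicate m ())) acc (Function.update_self ..) (Function.update_self ..)
    rw [Function.update_idem] at h₂
    have h₃ := tryProg_spec (A := A) 2 hm' (tryAt A m 1 (tryAt A m 0 L))
      (Function.update lev 0 (List.ofFn (tryAt A m 1 (tryAt A m 0 L))))
      (Function.update cnt 0 (List.replicate m ())) acc (Function.update_self ..)
      (Function.update_self ..)
    rw [Function.update_idem] at h₃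
    have h₄ := ih (Nat.le_of_succ_le hm) (tryAll A m L)
      (Function.update lev 0 (List.ofFn (tryAll A m L))) (Function.update_self ..)
    rw [Function.update_idem] at h₄
    have h := h₁.seq (h₂.seq h₃)
    refine (Spec.loop_cons (k := .cnt 0) (R := Any) (g := ()) (xs := List.replicate m ())
      (by simp [Stacks.get, List.replicate_succ]) (fun _ _ => trivial) (s₂ := idle A []
        (Function.update lev 0 (List.ofFn (tryAll A m L)))
        (Function.update cnt 0 (List.replicate m ())) acc) ?_ h₄).mono
      (t₁ := 1 + (tryTime n + (tryTime n + tryTime n) + _)) (le_of_eq ?_)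
    · simpa only [Stacks.set, Function.update_idem, tryAll] using h
    · ring

/-- The time for counting the vertices. -/
def countTime (n : ℕ) : ℕ := (n * 3 + 1) + ((n * 2 + 1) + 1)

/-- The time for the greedy procedure. -/
def greedyTime (n : ℕ) : ℕ :=
  countTime n + (((n + 1) * ((tryTime n + (tryTime n + tryTime n)) + 1) + 1) +
    (1 + ((n * 2 + 1) + (1 + 1))))

/-! ### The nested search. -/

/-- The program `p` takes the lists from level `i` and adds the value of `f` to `acc`. -/
def Solves (A : Fin n → Fin n → Bool) (p : Program) (i : Fin 4)
    (f : (Fin n → Finset (Fin 3)) → List Unit) (t : ℕ) : Prop :=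
  ∀ (L : Fin n → Finset (Fin 3)) (lev : Fin 4 → List (Finset (Fin 3))) (cnt : Fin 4 → List Unit)
    (acc : List Unit), lev i = List.ofFn L → (∀ k ≤ i, cnt k = []) → (∀ k < i, lev k = []) →
    Spec Any p (idle A [] lev cnt acc) Any
      (idle A [] (Function.update lev i []) cnt (f L ++ acc)) t

theorem solves_greedyProg : Solves A greedyProg 0 (greedyHits A) (greedyTime n) := by
  intro L lev cnt acc hl hc _
  have hc' : Function.update cnt 0 [] = cnt := by
    rw [← hc 0 le_rfl, Function.update_eq_self]
  have h₁ := initCount_spec (A := A) 0 L lev cnt acc hl (hc 0 le_rfl)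
  have h₂ := tryAll_loop_spec (A := A) (n + 1) le_rfl L lev cnt acc hl
  have h₃ := Spec.loop (k := .lev 0)
    (f := fun v m => { v with flag := v.flag && decide (m.card = 1) }) (p := skip)
    (fun _ u => idle A [] (Function.update lev 0 u) cnt acc)
    (fun d _ v => v.flag = d.all fun m => decide (m.card = 1))
    (fun _ _ => by simp [Stacks.get])
    (fun d g u => (Spec.skip.to (by simp [Stacks.set])).pre (by
      rintro _ ⟨v, hv, rfl⟩
      simp only [hv, List.all_cons, Bool.and_comm])) (List.ofFn (greedy A (n + 1) L))
  rw [hc'] at h₂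
  rw [List.length_ofFn] at h₃
  refine h₁.seq (h₂.seq ((Spec.load (R₂ := fun v => v.flag = true) fun _ _ => rfl).seq
    (h₃.seq ?_)))
  by_cases hs : ∀ y, (greedy A (n + 1) L y).card = 1
  · refine Spec.test_true (fun v hv => hv.trans (by simpa using hs)) ?_
    rw [greedyHits, if_pos hs]
    exact (Spec.push (k := .acc) (x := ()) fun _ _ => rfl).any
  · refine Spec.test_false (fun v hv => hv.trans (by simpa using hs)) ?_
    rw [greedyHits, if_neg hs]
    exact Spec.skip.any

/-- The time for a branch of the search. -/
def branchTime (n t : ℕ) : ℕ := decideTime n + ((n * 2 + 1) + ((n * 2 + 1) + t))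

/-- Level `j` is free beforehand and is emptied again by `p`, so the next branch finds levels and
counters as they were. -/
theorem branchProg_spec {p : Program} {i j : Fin 4} (hij : j < i)
    {f : (Fin n → Finset (Fin 3)) → List Unit} {t : ℕ} (hp : Solves A p j f t) (a : Fin 3)
    {m : ℕ} (hm : m ≤ n) (L : Fin n → Finset (Fin 3)) (lev : Fin 4 → List (Finset (Fin 3)))
    (cnt : Fin 4 → List Unit) (acc : List Unit) (hl : lev i = List.ofFn L)
    (hc : cnt i = List.replicate m ()) (hc' : ∀ k < i, cnt k = []) (hl' : ∀ k < i, lev k = []) :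
    Spec Any (branchProg i j p a) (idle A [] lev cnt acc) Any
      (idle A [] lev cnt (f (decideAt A m a L) ++ acc)) (branchTime n t) := by
  have h₁ := decideProg_spec (A := A) i a hm L lev cnt acc hl hc
  have h₂ := Spec.loop_any (k := .cur) (f := fun v m => { v with m := m })
    (p := push .cur' fun v => v.m)
    (fun d u => { idle A [] lev cnt acc with cur := u, cur' := d }) (fun _ _ => rfl)
    (fun d g u => (Spec.push (k := .cur') (x := g) (by rintro _ ⟨v, rfl⟩; rfl)).any)
    (List.ofFn (decideAt A m a L))
  have h₃ := cur'_to_lev_spec j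
    { idle A [] lev cnt acc with cur' := (List.ofFn (decideAt A m a L)).reverse } (hl' j hij)
  have h₄ := hp (decideAt A m a L)
    (Function.update lev j (List.ofFn (decideAt A m a L))) cnt acc (Function.update_self ..)
    (fun k hk => hc' k (hk.trans_lt hij))
    (fun k hk => by rw [Function.update_of_ne hk.ne]; exact hl' k (hk.trans hij))
  rw [Function.update_idem, ← hl' j hij, Function.update_eq_self] at h₄
  rw [hl' j hij] at h₄
  simp only [List.reverse_reverse, List.length_reverse, List.length_ofFn] at h₂ h₃
  exact h₁.seq (h₂.seq (h₃.seq h₄))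

/-- Later results land on top of `acc`, which is why `guessBelow` lists them in front. -/
theorem guess_loop_spec {p : Program} {i j : Fin 4} (hij : j < i)
    {f : (Fin n → Finset (Fin 3)) → List Unit} {t : ℕ} (hp : Solves A p j f t)
    (m : ℕ) (hm : m ≤ n + 1) (L : Fin n → Finset (Fin 3)) (lev : Fin 4 → List (Finset (Fin 3)))
    (cnt : Fin 4 → List Unit) (acc : List Unit) (hl : lev i = List.ofFn L)
    (hc : ∀ k < i, cnt k = []) (hl' : ∀ k < i, lev k = []) :
    Spec Any
      (loop (.cnt i) (fun v _ => v) (branchProg i j p 0 ;; branchProg i j p 1 ;; branchProg i j p 2))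
      (idle A [] lev (Function.update cnt i (List.replicate m ())) acc) Any
      (idle A [] lev (Function.update cnt i []) (guessBelow A f L m ++ acc))
      (m * ((branchTime n t + (branchTime n t + branchTime n t)) + 1) + 1) := by
  induction m generalizing acc with
  | zero => exact (Spec.loop_nil (by simp [Stacks.get])).mono (by simp)
  | succ m ih =>
    have h := fun a acc => branchProg_spec hij hp a (Nat.le_of_succ_le_succ hm) L lev
      (Function.update cnt i (List.replicate m ())) acc hl (Function.update_self ..)
      (fun k hk => by rw [Function.update_of_ne hk.ne]; exact hc k hk) hl'
    have h' := (h 0 acc).seq ((h 1 _).seq (h 2 _))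
    have h₄ := ih (Nat.le_of_succ_le hm) (f (decideAt A m 2 L) ++
      (f (decideAt A m 1 L) ++ (f (decideAt A m 0 L) ++ acc)))
    simp only [guessBelow, List.append_assoc]
    refine (Spec.loop_cons (k := .cnt i) (R := Any) (g := ()) (xs := List.replicate m ())
      (by simp [Stacks.get, List.replicate_succ]) (fun _ _ => trivial) ?_ h₄).mono
      (t₁ := 1 + (branchTime n t + (branchTime n t + branchTime n t) + _)) (le_of_eq ?_)
    · simpa only [Stacks.set, Function.update_idem] using h'
    · ring

/-- The time for a level of the search. -/
def guessTime (n t : ℕ) : ℕ :=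
  countTime n + (((n + 1) * ((branchTime n t + (branchTime n t + branchTime n t)) + 1) + 1) +
    (n * 2 + 1))

theorem Solves.guessProg {p : Program} {i j : Fin 4} (hij : j < i)
    {f : (Fin n → Finset (Fin 3)) → List Unit} {t : ℕ} (hp : Solves A p j f t) :
    Solves A (guessProg i j p) i (guess A f) (guessTime n t) := by
  intro L lev cnt acc hl hc hl'
  have hc' : Function.update cnt i [] = cnt := by
    rw [← hc i le_rfl, Function.update_eq_self]
  have h₁ := initCount_spec (A := A) i L lev cnt acc hl (hc i le_rfl)
  have h₂ := guess_loop_spec hij hp (n + 1) le_rfl L lev cnt acc hl (fun k hk => hc k hk.le) hl'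
  have h₃ := clear_lev_spec i (idle A [] lev cnt (guess A f L ++ acc))
  rw [hc'] at h₂
  simp only [hl, List.length_ofFn] at h₃
  exact h₁.seq (h₂.seq h₃)

/-! ### Parsing the input word. -/

/-- Reading a symbol of a row of the adjacency matrix. -/
theorem parse_row {R' : Reg → Prop} {s s' : Stacks} {t : ℕ} (bits : List Bool) (rest : List Γ')
    (h : Spec (fun v => v.phase = 3 ∨ v.phase = 4) parseProg
      { s with inp := rest, adj' := bits.reverse ++ s.adj' } R' s' t) :
    Spec (fun v => v.phase = 3 ∨ v.phase = 4) parseProg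
      { s with inp := bits.map Γ'.bit ++ rest } R' s' (bits.length * 3 + t) := by
  induction bits generalizing s with
  | nil => simpa using h
  | cons b bits ih =>
    have h₂ := ih (s := { s with adj' := b :: s.adj' }) (by simpa using h)
    refine (Spec.loop_cons (k := .inp) (R := fun v => v.phase = 4 ∧ v.b = b)
      (s₁ := { s with inp := .bit b :: (bits.map Γ'.bit ++ rest) }) (g := .bit b) (xs := bits.map Γ'.bit ++ rest) rfl ?_
      (Spec.test_true (fun v hv => decide_eq_true hv.1)
        ((Spec.push (k := .adj') (x := b) fun v hv => hv.2).post fun v hv => Or.inr hv.1))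
      h₂).mono ?_
    · rintro v (hv | hv) <;> simp [readSymbol, hv]
    · rw [List.length_cons]
      omega

/-- The set of colours with the given characteristic vector. -/
def ofBits (b₀ b₁ b₂ : Bool) : Finset (Fin 3) :=
  let l₀ : Finset (Fin 3) := if b₀ then insert 0 ∅ else ∅
  let l₁ := if b₁ then insert 1 l₀ else l₀
  if b₂ then insert 2 l₁ else l₁

/-- The comma resets phase and list, so the previous state of the parser is irrelevant. Each of the
four symbols costs four steps. -/
theorem parse_list {R' : Reg → Prop} {s s' : Stacks} {t : ℕ} (b₀ b₁ b₂ : Bool) (rest : List Γ')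
    (h : Spec (fun v => v.phase = 3 ∨ v.phase = 4) parseProg
      { s with inp := rest, cur' := ofBits b₀ b₁ b₂ :: s.cur' } R' s' t) :
    Spec Any parseProg
      { s with inp := .comma :: .bit b₀ :: .bit b₁ :: .bit b₂ :: rest } R' s' (16 + t) := by
  have hskip : ∀ (R : Reg → Prop) (s : Stacks), (∀ v, R v → v.phase ≠ 3 ∧ v.phase ≠ 4) →
      Spec R (test (fun v => decide (v.phase = 4)) (push .adj' fun v => v.b)
      (test (fun v => decide (v.phase = 3)) (push .cur' fun v => v.l) skip)) s R s (1 + (1 + 1)) :=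
    fun R s hR => Spec.test_false (fun v hv => decide_eq_false (hR v hv).2)
      (Spec.test_false (fun v hv => decide_eq_false (hR v hv).1) Spec.skip)
  let l₀ : Finset (Fin 3) := if b₀ then insert 0 ∅ else ∅
  let l₁ := if b₁ then insert 1 l₀ else l₀
  refine (Spec.loop_cons (k := .inp) (R := fun v => v.phase = 0 ∧ v.l = ∅) (g := .comma)
    (s₁ := { s with inp := .comma :: .bit b₀ :: .bit b₁ :: .bit b₂ :: rest }) rfl
    (fun v _ => ⟨rfl, rfl⟩) (hskip _ _ fun v hv => by simp [hv.1])
    (Spec.loop_cons (k := .inp) (R := fun v => v.phase = 1 ∧ v.l = l₀) (g := .bit b₀) rfl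
      (fun v hv => by simp [readSymbol, hv.1, hv.2, l₀]) (hskip _ _ fun v hv => by simp [hv.1])
      (Spec.loop_cons (k := .inp) (R := fun v => v.phase = 2 ∧ v.l = l₁) (g := .bit b₁) rfl
        (fun v hv => by simp [readSymbol, hv.1, hv.2, l₁]) (hskip _ _ fun v hv => by simp [hv.1])
        (Spec.loop_cons (k := .inp) (R := fun v => v.phase = 3 ∧ v.l = ofBits b₀ b₁ b₂)
          (g := .bit b₂) rfl
          (fun v hv => by simp [readSymbol, hv.1, hv.2, l₁, l₀, ofBits])
          (Spec.test_false (fun v hv => by simp [hv.1])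
            (Spec.test_true (fun v hv => by simp [hv.1])
              ((Spec.push (k := .cur') (x := ofBits b₀ b₁ b₂) fun v hv => hv.2).post
                fun v hv => Or.inl hv.1)))
          h)))).mono ?_
  omega

open scoped Classical in
theorem ofBits_decide_mem (l : Finset (Fin 3)) :
    ofBits (decide (0 ∈ l)) (decide (1 ∈ l)) (decide (2 ∈ l)) = l := by
  ext a
  unfold ofBits
  fin_cases a <;> by_cases h₀ : (0 : Fin 3) ∈ l <;> by_cases h₁ : (1 : Fin 3) ∈ l <;>
    by_cases h₂ : (2 : Fin 3) ∈ l <;> simp [h₀, h₁, h₂]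

open scoped Classical in
/-- The adjacency matrix of an instance. -/
noncomputable def adjMatrix (I : ListColouringInstance 3) (x y : Fin I.n) : Bool :=
  decide (I.G.Adj x y)

theorem adjMatrix_eq_true {I : ListColouringInstance 3} {x y : Fin I.n} :
    adjMatrix I x y = true ↔ I.G.Adj x y := by
  simp [adjMatrix]

theorem parse_vertex (I : ListColouringInstance 3) {s s' : Stacks} {t : ℕ} (x : Fin I.n)
    (rest : List Γ')
    (h : Spec Any parseProg
      { s with
        inp := rest
        adj' := (List.ofFn (adjMatrix I x)).reverse ++ s.adj'
        cur' := I.L x :: s.cur' } Any s' t) :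
    Spec Any parseProg { s with inp := I.encodeVertex x ++ rest } Any s'
      (16 + (I.n * 3 + t)) := by
  have h₁ := parse_row (s := { s with cur' := I.L x :: s.cur' }) (List.ofFn (adjMatrix I x)) rest
    (h.pre fun _ _ => trivial)
  rw [← ofBits_decide_mem (I.L x)] at h₁
  have h₂ := parse_list (s := s) _ _ _ _ h₁
  rw [List.length_ofFn] at h₂
  simpa [ListColouringInstance.encodeVertex, List.map_ofFn, Function.comp_def, adjMatrix,
    List.ofFn_succ] using h₂

/-- Both stacks are filled in reverse; the next two loops of `mainProg` turn them around. -/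
theorem parse_vertices (I : ListColouringInstance 3) (xs : List (Fin I.n)) (s : Stacks) :
    Spec Any parseProg { s with inp := (xs.map I.encodeVertex).flatten } Any
      { s with
        inp := []
        adj' := (rows (adjMatrix I) xs).reverse ++ s.adj'
        cur' := (xs.map I.L).reverse ++ s.cur' }
      (xs.length * (16 + I.n * 3) + 1) := by
  induction xs generalizing s with
  | nil => exact (Spec.loop_nil rfl).mono (by simp)
  | cons x xs ih =>
    have h := ih { s with
      adj' := (List.ofFn (adjMatrix I x)).reverse ++ s.adj'
      cur' := I.L x :: s.cur' }
    have h' := parse_vertex I (s := s) x _ h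
    simp only [List.map_cons, List.flatten_cons, rows, List.flatMap_cons, List.reverse_append,
      List.reverse_cons, List.append_assoc, List.singleton_append] at h' ⊢
    refine h'.mono (le_of_eq ?_)
    rw [List.length_cons]
    ring

/-! ### The whole program and its running time. -/

/-- This serves to bound the time for emptying `acc` at the end. -/
theorem length_guessBelow_le {n : ℕ} {A : Fin n → Fin n → Bool}
    {f : (Fin n → Finset (Fin 3)) → List Unit} {b : ℕ} (hf : ∀ L, (f L).length ≤ b)
    (L : Fin n → Finset (Fin 3)) (m : ℕ) : (guessBelow A f L m).length ≤ m * (3 * b) := by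
  induction m with
  | zero => simp [guessBelow]
  | succ m ih =>
    have h₀ := hf (decideAt A m 0 L)
    have h₁ := hf (decideAt A m 1 L)
    have h₂ := hf (decideAt A m 2 L)
    simp only [guessBelow, List.length_append]
    linarith

theorem length_hits_le {n : ℕ} (A : Fin n → Fin n → Bool) (L : Fin n → Finset (Fin 3)) :
    (hits A L).length ≤ (n + 1) * (3 * ((n + 1) * (3 * ((n + 1) * (3 * 1))))) :=
  length_guessBelow_le (fun L => length_guessBelow_le (fun L => length_guessBelow_le
    (fun L => by unfold greedyHits; split_ifs <;> simp) L _) L _) L _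

/-- The time for the whole program. -/
def mainTime (n : ℕ) : ℕ :=
  (n * (16 + n * 3) + 1) + ((n * n * 2 + 1) + ((n * 2 + 1) +
    (guessTime n (guessTime n (guessTime n (greedyTime n))) + ((n * n * 2 + 1) + (1 +
      (((n + 1) * (3 * ((n + 1) * (3 * ((n + 1) * (3 * 1))))) * 2 + 1) + (1 + 1)))))))

/-- All stacks except `out` end empty and the register is reset, as the halting configuration of a
`FinTM2` requires. -/
theorem mainProg_spec (I : ListColouringInstance 3) :
    Spec Any mainProg { inp := I.encode } (fun v => v = initReg)
      { out := [!(hits (adjMatrix I) I.L).isEmpty] } (mainTime I.n) := by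
  have h₁ := parse_vertices I (List.finRange I.n) {}
  have h₂ := restoreAdj_spec
    { adj' := (rows (adjMatrix I) (List.finRange I.n)).reverse
      cur' := (List.ofFn I.L).reverse }
  have h₃ := cur'_to_lev_spec 3
    { adj := rows (adjMatrix I) (List.finRange I.n)
      cur' := (List.ofFn I.L).reverse } rfl
  have h₄ := (((solves_greedyProg (A := adjMatrix I)).guessProg (i := 1) (by decide)).guessProg
    (i := 2) (by decide)).guessProg (i := 3) (by decide) I.L
    (Function.update (fun _ => []) 3 (List.ofFn I.L)) (fun _ => []) []
    (Function.update_self ..) (fun _ _ => rfl)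
    (fun k hk => Function.update_of_ne hk.ne _ _)
  have h₅ := Spec.loop_any (k := .adj) (f := fun v _ => v) (p := skip)
    (fun _ u => { adj := u, acc := hits (adjMatrix I) I.L }) (fun _ _ => rfl)
    (fun _ _ _ => Spec.skip.any) (rows (adjMatrix I) (List.finRange I.n))
  have h₆ := Spec.loop (k := .acc) (f := fun v _ => { v with flag := true }) (p := skip)
    (fun _ u => { acc := u }) (fun d _ v => v.flag = !d.isEmpty) (fun _ _ => rfl)
    (fun d g u => Spec.skip.pre (by rintro _ ⟨v, -, rfl⟩; rfl)) (hits (adjMatrix I) I.L)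
  have h₇ := Spec.push (R := fun v => v.flag = !(hits (adjMatrix I) I.L).isEmpty)
    (k := .out) (s := {}) (f := fun v => v.flag) fun v hv => hv
  have hu : Function.update (fun _ : Fin 4 => ([] : List (Finset (Fin 3)))) 3 [] = fun _ => [] :=
    Function.update_eq_self 3 _
  simp only [List.append_nil, List.reverse_reverse, List.length_reverse, List.length_ofFn,
    length_rows, List.length_finRange, ← List.ofFn_eq_map, List.isEmpty_reverse,
    Function.update_idem, hu] at h₁ h₂ h₃ h₄ h₅ h₆
  -- The time for emptying `acc` depends on the instance; it is replaced by a bound in `n` alone.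
  have h₆' := h₆.mono (Nat.succ_le_succ (Nat.mul_le_mul_right 2 (length_hits_le _ _)))
  exact h₁.seq (h₂.seq (h₃.seq (h₄.seq (h₅.seq
    ((Spec.load (R₂ := fun v => v.flag = !([] : List Unit).isEmpty) fun _ _ => rfl).seq
      (h₆'.seq (h₇.seq (Spec.load fun _ _ => rfl))))))))

/-- A function that is given by a polynomial. -/
def IsPoly (f : ℕ → ℕ) : Prop :=
  ∃ p : Polynomial ℕ, ∀ n, f n = p.eval n

namespace IsPoly

theorem const (c : ℕ) : IsPoly fun _ => c := ⟨Polynomial.C c, by simp⟩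

theorem id : IsPoly fun n => n := ⟨Polynomial.X, by simp⟩

theorem add {f g : ℕ → ℕ} (hf : IsPoly f) (hg : IsPoly g) : IsPoly fun n => f n + g n := by
  obtain ⟨p, hp⟩ := hf
  obtain ⟨q, hq⟩ := hg
  exact ⟨p + q, by simp [hp, hq]⟩

theorem mul {f g : ℕ → ℕ} (hf : IsPoly f) (hg : IsPoly g) : IsPoly fun n => f n * g n := by
  obtain ⟨p, hp⟩ := hf
  obtain ⟨q, hq⟩ := hg
  exact ⟨p * q, by simp [hp, hq]⟩

theorem passTime : IsPoly passTime := by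
  unfold ListThreeColouring.passTime
  repeat' first | exact const _ | exact id | apply add | apply mul

theorem propagateTime : IsPoly propagateTime := by
  unfold ListThreeColouring.propagateTime
  repeat' first | exact const _ | exact id | exact passTime | apply add | apply mul

theorem decideTime : IsPoly decideTime := by
  unfold ListThreeColouring.decideTime
  repeat' first | exact const _ | exact id | exact propagateTime | apply add

theorem tryTime : IsPoly tryTime := by
  unfold ListThreeColouring.tryTime
  repeat' first | exact const _ | exact id | exact decideTime | apply add

theorem countTime : IsPoly countTime := by
  unfold ListThreeColouring.countTime
  repeat' first | exact const _ | exact id | apply add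

theorem greedyTime : IsPoly greedyTime := by
  unfold ListThreeColouring.greedyTime
  repeat' first | exact const _ | exact id | exact tryTime | exact countTime | apply add | apply mul

theorem guessTime {f : ℕ → ℕ} (hf : IsPoly f) : IsPoly fun n => guessTime n (f n) := by
  unfold ListThreeColouring.guessTime branchTime
  repeat' first
    | exact const _ | exact id | exact hf | exact decideTime | exact countTime
    | apply add | apply mul

theorem mainTime : IsPoly mainTime := by
  unfold ListThreeColouring.mainTime
  repeat' first
    | exact const _ | exact id | exact greedyTime.guessTime.guessTime.guessTime
    | apply add | apply mul

end IsPoly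

/-- Natural coefficients make evaluation monotone, which allows passing from `n` to the input
length. -/
theorem eval_mono (p : Polynomial ℕ) {m n : ℕ} (h : m ≤ n) : p.eval m ≤ p.eval n := by
  rw [Polynomial.eval_eq_sum_range, Polynomial.eval_eq_sum_range]
  gcongr

theorem hasColouring_iff (I : ListColouringInstance 3) :
    I.HasColouring ↔ ∃ c, IsListColouring (adjMatrix I) I.L c := by
  constructor
  · rintro ⟨c, hc⟩
    exact ⟨c, fun x y hxy => c.valid (adjMatrix_eq_true.1 hxy), hc⟩
  · rintro ⟨c, hc, hc'⟩
    exact ⟨SimpleGraph.Coloring.mk c fun {x y} hxy => hc x y (adjMatrix_eq_true.2 hxy), hc'⟩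

end ListThreeColouring

open ListThreeColouring in
theorem mainTheorem5 :
    IsPolyTimeSolvable (ListColouringInstance.encode (k := 3))
      (fun I => I.G.IsQuasiClawFree ∧ I.G.ediam ≤ 2)
      ListColouringInstance.HasColouring := by
  classical
  obtain ⟨p, hp⟩ := IsPoly.mainTime
  refine ⟨{
    tm := mainProg.machine .inp .out initReg
    inputAlphabet := Equiv.refl _
    outputAlphabet := Equiv.refl _
    -- The summand `1` pays for the halting step.
    time := p + 1
    outputsFun := fun ⟨I, hG, hd⟩ => ?_ }⟩
  have hnil : ({} : Stacks).get = fun _ => [] := by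
    funext k
    cases k <;> rfl
  have hspec : ∃ t' ≤ mainTime I.n, mainProg.Exec initReg
      (Function.update (fun _ => []) .inp (I.encode.map id)) initReg
      (Function.update (fun _ => []) .out ([decide I.HasColouring].map id)) t' := by
    rw [List.map_id, List.map_id]
    obtain ⟨_, rfl, t', ht', he⟩ := mainProg_spec I initReg trivial
    refine ⟨t', ht', ?_⟩
    have hans : (!(hits (adjMatrix I) I.L).isEmpty) = decide I.HasColouring := by
      rw [Bool.eq_iff_iff, decide_eq_true_iff, hasColouring_iff,
        ← hits_ne_nil_iff (fun _ _ => adjMatrix_eq_true) hG hd]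
      simp
    rw [← hans, ← hnil, ← Stacks.get_set, ← Stacks.get_set]
    exact he
  have hle : mainTime I.n + 1 ≤ (p + 1).eval I.encode.length := by
    rw [Polynomial.eval_add, Polynomial.eval_one, hp]
    refine Nat.add_le_add_right (eval_mono p ?_) 1
    rw [ListColouringInstance.length_encode]
    exact Nat.le_mul_of_pos_right _ (by omega)
  have h := StackProg.Prog.outputsInTime hspec
  exact ⟨h.toEvalsTo, h.steps_le_m.trans hle⟩
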